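/- **Model.** Graphs are finite, simple and connected. Every node has an input label and gives a label to each of its incident edges (this encodes orientations). Nodes have distinct identifiers from $\{0,\dots,n^c-1\}$, where $n$ is the number of nodes and $c\ge 1$ is a fixed constant. A deterministic LOCAL algorithm that knows $n$ and runs in time $t$ is a map from radius-$t(n)$ labelled neighbourhoods (with identifiers) to outputs; it solves a problem if its output is valid on all instances and for all identifier assignments. The time complexity of a problem is the slowest-growing $T:\mathbb N\to\mathbb N$ such that it is solvable in time $T$, i.e. it is solvable in time $T$, and $T=O(t)$ whenever it is solvable in time $t$. **Link machines.** A link machine $M$ has $k$ registers and a program of $p$ instructions of the forms $a\gets b+c$; $a\gets 1$; "if $a=b$ (or: if $a\ne b$) execute the next $s$ instructions, otherwise skip them". All registers start at $1$; $g(\ell)$, the *growth* of $M$, is the maximum register value after $\ell$ executions of the whole program. Assume that $g$ is non-decreasing and unbounded, and that some register $m$ has the maximum value after every number of executions. Put $f(\ell)=\ell\, g(\ell)$ and $f^{-1}(x)=\min\{j: f(j)\ge x\}$. **The problem $\Pi$.** Let $\Pi$ be an LCL problem on directed cycles (of length at least 3) with inputs in $\{0,1\}$ and a finite set $\Gamma$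 of output labels: for some constant $s$, it is prescribed which sequences of (input, output) pairs are allowed on at most $s$ consecutive nodes. Let $T$ be the time complexity of $\Pi$ (in particular $\Pi$ is solvable on all such cycles), and let $\hat n$ be the smallest number with $n\le \hat n\cdot f^{-1}(T(\hat n))$. **The problem $\Pi_M$.** Instances are connected graphs of maximum degree at most $\Delta$, where $\Delta\ge 2k(p+1)+4$ is a constant. Each node $v$ has an input bit $i(v)$ and gives to each incident edge a set of labels from $\mathsf U,\mathsf D,\mathsf L,\mathsf R$ and $(r,j)$ ($r$ a register, $0\le j\le p$). Write $v(x_1,\dots,x_q)$ for the node reached from $v$ by following these labels. The *local constraints* at $v$ are: 1. each label occurs on exactly one incident edge, except that one of $\mathsf U$, $\mathsf D$ may be missing; $\mathsf U,\mathsf D,\mathsf L,\mathsf R$ are on different edges; 2. an edge labelled $\mathsf U,\mathsf D,\mathsf L,\mathsf R$ has the opposite label at its other end; if $v$ has a $\mathsf D$-edge, then $v(\mathsf D,\mathsf R,\mathsf U)=v(\mathsf R)$; if $v$ has no $\mathsf D$-edge (no $\mathsf U$-edge), neither have $v(\mathsf L),v(\mathsf R)$; 3. if $v$ has no $\mathsf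 D$-edge, $\mathsf R$ and $(r,0)$ are on the same edge for all $r$; otherwise $v((r,0))=v(\mathsf D,(r,p),\mathsf U)$ for all $r$; 4. instructions $j=1,\dots,p$ are processed in order: for $a\gets 1$, $\mathsf R$ and $(a,j)$ are on the same edge; for $a\gets b+c$, $v((a,j))=v((b,j-1),(c,j-1))$; in both cases $(r,j-1),(r,j)$ are on the same edge for all $r\neq a$; for a conditional, $(r,j-1),(r,j)$ are on the same edge for all $r$, and the condition is evaluated by whether $(a,j-1),(b,j-1)$ are on the same edge; for each skipped instruction $j$, $(r,j-1),(r,j)$ are on the same edge for all $r$; 5. if $v$ has no $\mathsf U$-edge, then $v((m,p),(m,p),(m,p))=v$. Outputs are the labels in $\Gamma$, an error label $\mathsf E$, error pointers $\mathsf R$ or $\mathsf U$ with a counter mod 2 and a label $c_e\in\{0,1\}$, and the empty output. An output labelling is valid if at each node $v$: 1. $v$ outputs $\mathsf E$ if and only if the local constraints fail at $v$ or at a neighbour of $v$; 2. if $v$ outputs a label of $\Gamma$, it has no $\mathsf D$-edge, and each sequence of at most $s$ nodes, consecutive along $\mathsf R$-edges and starting at $v$, all with outputs in $\Gamma$, is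 allowed by $\Pi$; 3. if $v$ has empty output, it has a $\mathsf D$-edge; 4. if $v$ outputs a pointer $\mathsf R$, it has no $\mathsf D$-edge, $v(\mathsf R)$ outputs $\mathsf E$ or an error pointer, and if $v(\mathsf R)$ outputs a pointer $\mathsf R$ then its counter differs from that of $v$; 5. if $v$ outputs a pointer $\mathsf U$, then $v(\mathsf U)$ exists and either outputs $\mathsf E$ and $c_e(v)=i(v(\mathsf U))$, or outputs an error pointer with the same label $c_e$ as $v$. **Theorem.** $\Pi_M$ cannot be solved in $o\bigl(f^{-1}(T(\hat n))\bigr)$ rounds: there is no function $t$ with $t(n)=o\bigl(f^{-1}(T(\hat n))\bigr)$ as $n\to\infty$ such that $\Pi_M$ can be solved in time $t$. -/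

import Mathlib

open Filter Asymptotics

/-! ## The LOCAL model -/

/-- A labelled graph: `node v` is the input label of the node `v`, and `half v u` is the label that
`v` gives to its incident edge `{v, u}` (it has no meaning when `u`, `v` are not adjacent).
Orientations of edges are a special case of such labels. -/
structure LabGraph (σ τ V : Type) where
  graph : SimpleGraph V
  node : V → σ
  half : V → V → τ

/-- What a node knows after gathering a neighbourhood; nodes are named by their identifiers.
A member `(i, s, m)` of `nodes` is a node with identifier `i`, input label `s`, and `m x` incident
edges to which it gives the label `x`. A member `(i, j, x)` of `edges` is an edge
from node `i` to node `j` to which `i` gives the label `x`. -/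
structure View (σ τ : Type) where
  root : ℕ
  nodes : Set (ℕ × σ × (τ → ℕ))
  edges : Set (ℕ × ℕ × τ)

/-- The radius-`T` neighbourhood of `v` in a connected labelled graph with identifiers `ident`:
all nodes within distance `T`, and all edges between two such nodes, with their labels. -/
noncomputable def LabGraph.view {σ τ V : Type} (I : LabGraph σ τ V) (ident : V → ℕ)
    (T : ℕ) (v : V) : View σ τ where
  root := ident v
  nodes := {q | ∃ u, I.graph.dist v u ≤ T ∧
    q = (ident u, I.node u, fun x => {w | I.graph.Adj u w ∧ I.half u w = x}.ncard)}
  edges := {q | ∃ u w, I.graph.dist v u ≤ T ∧ I.graph.dist v w ≤ T ∧ I.graph.Adj u w ∧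
    q = (ident u, ident w, I.half u w)}

/-- A graph problem: a family of connected labelled graphs (the instances) and, for each of them,
the set of valid output labellings. -/
structure GraphProblem (σ τ γ : Type) where
  IsInstance : ∀ {V : Type}, LabGraph σ τ V → Prop
  Valid : ∀ {V : Type}, LabGraph σ τ V → (V → γ) → Prop

/-- The problem `P` can be solved in time `t` by a deterministic LOCAL algorithm: a `T`-round
algorithm is a map from radius-`T` neighbourhoods to local outputs, the algorithm knows the number
`n` of nodes, runs for at most `t n` rounds, and has to be correct for all assignments of
pairwise distinct identifiers from `{0, …, n ^ c - 1}`. -/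
def GraphProblem.SolvableInTime {σ τ γ : Type} (P : GraphProblem σ τ γ) (c : ℕ)
    (t : ℕ → ℕ) : Prop :=
  ∃ A : ℕ → View σ τ → γ,
    ∀ (V : Type) [Fintype V] (I : LabGraph σ τ V), P.IsInstance I →
      ∀ ident : V → ℕ, Function.Injective ident → (∀ v, ident v < Fintype.card V ^ c) →
        P.Valid I (fun v => A (Fintype.card V) (I.view ident (t (Fintype.card V)) v))

/-- `T` is the time complexity of `P`: the slowest-growing function such that `P` can be solved
in time `T`. -/
def GraphProblem.IsTimeComplexity {σ τ γ : Type} (P : GraphProblem σ τ γ) (c : ℕ)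
    (T : ℕ → ℕ) : Prop :=
  P.SolvableInTime c T ∧
    ∀ t : ℕ → ℕ, P.SolvableInTime c t →
      (fun n => (T n : ℝ)) =O[atTop] (fun n => (t n : ℝ))

/-! ## Locally checkable labellings of directed cycles -/

/-- An LCL problem on directed cycles with input labels `Bool` and output labels `Γ`. Its local
constraints say which sequences of (input, output) pairs may be seen on at most `size`
consecutive nodes. -/
structure CycleLCL (Γ : Type) where
  size : ℕ
  allowed : List (Bool × Γ) → Prop

/-- The local constraints hold on every sequence of at most `size` consecutive nodes, starting at
`v`, all of which have an output label from `Γ`. Here `next u w` means that `w` is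
a successor of `u`, and `out u y` that `y` is the output label of `u`. -/
def CycleLCL.ConstraintsAt {Γ V : Type} (P : CycleLCL Γ) (next : V → V → Prop) (inp : V → Bool)
    (out : V → Γ → Prop) (v : V) : Prop :=
  ∀ j < P.size, ∀ (u : Fin (j + 1) → V) (y : Fin (j + 1) → Γ), u 0 = v →
    (∀ i : Fin j, next (u i.castSucc) (u i.succ)) → (∀ i, out (u i) (y i)) →
      P.allowed (List.ofFn fun i => (inp (u i), y i))

/-- A directed cycle with at least three nodes: each node labels the edge to its successor with
`true` and the edge to its predecessor with `false`. -/
def IsDirectedCycle {σ V : Type} (I : LabGraph σ Bool V) : Prop :=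
  ∃ n : ℕ, 3 ≤ n ∧ ∃ e : ZMod n ≃ V,
    (∀ a b, I.graph.Adj (e a) (e b) ↔ b = a + 1 ∨ a = b + 1) ∧
    ∀ a, I.half (e a) (e (a + 1)) = true ∧ I.half (e (a + 1)) (e a) = false

/-- An LCL problem on directed cycles, as a graph problem. -/
def CycleLCL.problem {Γ : Type} (P : CycleLCL Γ) : GraphProblem Bool Bool Γ where
  IsInstance I := IsDirectedCycle I
  Valid I out := ∀ v, P.ConstraintsAt (fun u w => I.graph.Adj u w ∧ I.half u w = true) I.node
    (fun u y => out u = y) v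

/-! ## Link machines -/

/-- Instructions of a link machine with `k` registers. -/
inductive Instr (k : ℕ) where
  /-- `a ← b + c` -/
  | add (a b c : Fin k)
  /-- `a ← 1` -/
  | reset (a : Fin k)
  /-- if `a = b`, execute the next `s` instructions, otherwise skip them -/
  | ifEq (a b : Fin k) (s : ℕ)
  /-- if `a ≠ b`, execute the next `s` instructions, otherwise skip them -/
  | ifNe (a b : Fin k) (s : ℕ)

/-- A link machine: a number of registers and a program. -/
structure LinkMachine where
  k : ℕ
  prog : List (Instr k)

/-- One instruction; a state consists of the register values and of the number of
instructions that are still to be skipped. -/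
def Instr.step {k : ℕ} (q : (Fin k → ℕ) × ℕ) (ins : Instr k) : (Fin k → ℕ) × ℕ :=
  match q, ins with
  | (r, d + 1), _ => (r, d)
  | (r, 0), .add a b c => (Function.update r a (r b + r c), 0)
  | (r, 0), .reset a => (Function.update r a 1, 0)
  | (r, 0), .ifEq a b s => (r, if r a = r b then 0 else s)
  | (r, 0), .ifNe a b s => (r, if r a ≠ r b then 0 else s)

namespace LinkMachine

/-- The length of the program. -/
def p (M : LinkMachine) : ℕ := M.prog.length

/-- One execution: a single run through the program. -/
def exec (M : LinkMachine) (r : Fin M.k → ℕ) : Fin M.k → ℕ :=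
  (M.prog.foldl Instr.step (r, 0)).1

/-- The register values after `l` executions, starting from all registers set to `1`. -/
def regs (M : LinkMachine) (l : ℕ) : Fin M.k → ℕ := M.exec^[l] fun _ => 1

/-- The growth of `M`: the maximum register value after `l` executions. -/
def growth (M : LinkMachine) (l : ℕ) : ℕ := Finset.univ.sup (M.regs l)

/-- `f(l) = l * g(l)`, where `g` is the growth of `M`. -/
def speedup (M : LinkMachine) (l : ℕ) : ℕ := l * M.growth l

end LinkMachine

/-- `f⁻¹(x) = min {m : f(m) ≥ x}`. -/
noncomputable def genInv (f : ℕ → ℕ) (x : ℕ) : ℕ := sInf {m | x ≤ f m}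

/-- The smallest number `m` with `n ≤ m * f⁻¹(T(m))`. -/
noncomputable def nHat (f T : ℕ → ℕ) (n : ℕ) : ℕ := sInf {m | n ≤ m * genInv f (T m)}

/-! ## Labels of link machine encoding graphs and their local constraints -/

/-- The four grid directions up, down, left, right. -/
inductive Dir where
  | U | D | L | R

/-- The opposite direction. -/
def Dir.opp : Dir → Dir
  | .U => .D
  | .D => .U
  | .L => .R
  | .R => .L

/-- Edge labels: grid directions, and link labels `(r, i)` for a register `r` and
`i ∈ {0, …, p}`. -/
inductive EdgeLabel (M : LinkMachine) where
  | dir (d : Dir)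
  | link (r : Fin M.k) (i : Fin (M.p + 1))

/-- Inputs of the problem for `M`: every node has an input bit and gives a set of edge labels to
each of its incident edges. -/
abbrev EncGraph (M : LinkMachine) (V : Type) := LabGraph Bool (Set (EdgeLabel M)) V

namespace EncGraph

variable {M : LinkMachine} {V : Type}

/-- `u` is at the other end of an edge that `v` labels with (at least) `x`. -/
def Step (I : EncGraph M V) (x : EdgeLabel M) (v u : V) : Prop :=
  I.graph.Adj v u ∧ x ∈ I.half v u

/-- `v` has an incident edge that it labels with `x`. -/
def Has (I : EncGraph M V) (x : EdgeLabel M) (v : V) : Prop := ∃ u, I.Step x v u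

/-- Node `v` gives the labels `x` and `y` to one and the same edge. -/
def SameEdge (I : EncGraph M V) (x y : EdgeLabel M) (v : V) : Prop :=
  ∃ u, I.Step x v u ∧ I.Step y v u

/-- `u` can be reached from `v` by following edges with the specified labels. -/
def Reach (I : EncGraph M V) : List (EdgeLabel M) → V → V → Prop
  | [], v, u => v = u
  | x :: xs, v, u => ∃ w, I.Step x v w ∧ Reach I xs w u

/-- `v(x₁, …, xₘ) = u`: following the labels leads from `v` to `u` and to no other node. -/
def LeadsTo (I : EncGraph M V) (xs : List (EdgeLabel M)) (v u : V) : Prop :=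
  ∀ w, I.Reach xs v w ↔ w = u

/-- `v(x₁, …, xₘ) = v(y₁, …, yₗ)`, where both sides are defined. -/
def SameEnd (I : EncGraph M V) (xs ys : List (EdgeLabel M)) (v : V) : Prop :=
  ∃ u, I.LeadsTo xs v u ∧ I.LeadsTo ys v u

end EncGraph

/-- The label `(r, i)`, used for `i ≤ p` only. -/
def LinkMachine.lk (M : LinkMachine) (r : Fin M.k) (i : ℕ) : EdgeLabel M :=
  .link r (Fin.ofNat (M.p + 1) i)

namespace EncGraph

variable {M : LinkMachine} {V : Type}

/-- (1) Basic properties of the labelling. -/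
def Basic (I : EncGraph M V) (v : V) : Prop :=
  (∀ r i, ∃! u, I.Step (.link r i) v u) ∧
  (∃! u, I.Step (.dir .L) v u) ∧ (∃! u, I.Step (.dir .R) v u) ∧
  (∀ u w, I.Step (.dir .U) v u → I.Step (.dir .U) v w → u = w) ∧
  (∀ u w, I.Step (.dir .D) v u → I.Step (.dir .D) v w → u = w) ∧
  (I.Has (.dir .U) v ∨ I.Has (.dir .D) v) ∧
  (∀ d d' : Dir, d ≠ d' → ¬ I.SameEdge (.dir d) (.dir d') v)

/-- (2) Validity of the grid structure. -/
def Grid (I : EncGraph M V) (v : V) : Prop :=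
  (∀ d u, I.Step (.dir d) v u → I.Step (.dir d.opp) u v) ∧
  (I.Has (.dir .D) v → I.SameEnd [.dir .D, .dir .R, .dir .U] [.dir .R] v) ∧
  (¬ I.Has (.dir .D) v → ∀ u, I.Step (.dir .L) v u ∨ I.Step (.dir .R) v u →
    ¬ I.Has (.dir .D) u) ∧
  (¬ I.Has (.dir .U) v → ∀ u, I.Step (.dir .L) v u ∨ I.Step (.dir .R) v u →
    ¬ I.Has (.dir .U) u)

/-- (3) Initialisation of the registers. -/
def InitRegs (I : EncGraph M V) (v : V) : Prop :=
  (¬ I.Has (.dir .D) v → ∀ r, I.SameEdge (.dir .R) (M.lk r 0) v) ∧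
  (I.Has (.dir .D) v → ∀ r, I.SameEnd [M.lk r 0] [.dir .D, M.lk r M.p, .dir .U] v)

/-- Register `r` does not change from step `i` to step `i + 1`. -/
def Keep (I : EncGraph M V) (v : V) (i : ℕ) (r : Fin M.k) : Prop :=
  I.SameEdge (M.lk r i) (M.lk r (i + 1)) v

/-- (4) Execution of a program, the first instruction of which leads from step `i` to step
`i + 1`, when `d` instructions are still to be skipped. -/
def ExecOK (I : EncGraph M V) (v : V) : List (Instr M.k) → ℕ → ℕ → Prop
  | [], _, _ => True
  | _ :: rest, i, d + 1 => (∀ r, I.Keep v i r) ∧ ExecOK I v rest (i + 1) d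
  | .reset a :: rest, i, 0 =>
      I.SameEdge (.dir .R) (M.lk a (i + 1)) v ∧ (∀ r, r ≠ a → I.Keep v i r) ∧
        ExecOK I v rest (i + 1) 0
  | .add a b c :: rest, i, 0 =>
      I.SameEnd [M.lk a (i + 1)] [M.lk b i, M.lk c i] v ∧ (∀ r, r ≠ a → I.Keep v i r) ∧
        ExecOK I v rest (i + 1) 0
  | .ifEq a b s :: rest, i, 0 =>
      (∀ r, I.Keep v i r) ∧
        (I.SameEdge (M.lk a i) (M.lk b i) v → ExecOK I v rest (i + 1) 0) ∧
        (¬ I.SameEdge (M.lk a i) (M.lk b i) v → ExecOK I v rest (i + 1) s)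
  | .ifNe a b s :: rest, i, 0 =>
      (∀ r, I.Keep v i r) ∧
        (¬ I.SameEdge (M.lk a i) (M.lk b i) v → ExecOK I v rest (i + 1) 0) ∧
        (I.SameEdge (M.lk a i) (M.lk b i) v → ExecOK I v rest (i + 1) s)

/-- (5) On the top row the link edges of the maximum register `m` form 3-cycles. -/
def TopOK (I : EncGraph M V) (m : Fin M.k) (v : V) : Prop :=
  ¬ I.Has (.dir .U) v → I.LeadsTo [M.lk m M.p, M.lk m M.p, M.lk m M.p] v v

/-- The local constraints of link machine encoding graphs hold at `v`. -/
def LocalOK (I : EncGraph M V) (m : Fin M.k) (v : V) : Prop :=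
  I.Basic v ∧ I.Grid v ∧ I.InitRegs v ∧ I.ExecOK v M.prog 0 0 ∧ I.TopOK m v

/-- The local constraints are violated at `v` or at one of its neighbours. -/
def NearError (I : EncGraph M V) (m : Fin M.k) (v : V) : Prop :=
  ¬ I.LocalOK m v ∨ ∃ u, I.graph.Adj v u ∧ ¬ I.LocalOK m u

end EncGraph

/-! ## The problem `Π_M` -/

/-- Output labels: labels of `Π`, the error label, error pointers to the right or up (with a
counter mod 2 and a label `c_e`), and the empty output. -/
inductive OutLabel (Γ : Type) where
  | sol (y : Γ)
  | err
  | ptrR (counter ce : Bool)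
  | ptrU (counter ce : Bool)
  | empty

/-- The output is an error pointer with the label `ce`. -/
def OutLabel.IsPtr {Γ : Type} (o : OutLabel Γ) (ce : Bool) : Prop :=
  ∃ b, o = .ptrR b ce ∨ o = .ptrU b ce

/-- The correctness of an output labelling at the node `v`. -/
def EncGraph.OutputOK {M : LinkMachine} {V Γ : Type} (I : EncGraph M V) (m : Fin M.k)
    (P : CycleLCL Γ) (out : V → OutLabel Γ) (v : V) : Prop :=
  (I.NearError m v ↔ out v = .err) ∧
  (∀ y, out v = .sol y → ¬ I.Has (.dir .D) v) ∧
  P.ConstraintsAt (I.Step (.dir .R)) I.node (fun u y => out u = .sol y) v ∧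
  (out v = .empty → I.Has (.dir .D) v) ∧
  (∀ b ce, out v = .ptrR b ce → ¬ I.Has (.dir .D) v ∧
    (∃ u, I.Step (.dir .R) v u ∧ (out u = .err ∨ ∃ ce', (out u).IsPtr ce')) ∧
    ∀ u, I.Step (.dir .R) v u → ∀ b' ce', out u = .ptrR b' ce' → b ≠ b') ∧
  (∀ b ce, out v = .ptrU b ce →
    ∃ u, I.Step (.dir .U) v u ∧ ((out u = .err ∧ ce = I.node u) ∨ (out u).IsPtr ce))

/-- The problem `Π_M` on connected graphs of maximum degree at most `Δ`, for the LCL problem `P`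
on directed cycles and the link machine `M` with maximum register `m`. -/
def linkProblem (M : LinkMachine) (m : Fin M.k) {Γ : Type} (P : CycleLCL Γ) (Δ : ℕ) :
    GraphProblem Bool (Set (EdgeLabel M)) (OutLabel Γ) where
  IsInstance I := I.graph.Connected ∧ ∀ v, (I.graph.neighborSet v).ncard ≤ Δ
  Valid I out := ∀ v, EncGraph.OutputOK I m P out v

/-!
The lower bound is a simulation. Given a fast algorithm for the link machine problem, a cycle of
length `N` is thickened to a grid with `N` columns and `h = f⁻¹(T(N))` rows, whose link edges in
row `y` have as lengths the register values during the execution with index `y`; row `0` carries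
the inputs of the cycle (`gridGraph`, `gridInput`). Such a grid satisfies the local constraints
everywhere except possibly in its top row (`gridGraph_localOK`), so errors can be seen only in the
two topmost rows.

Suppose that the algorithm runs for `t` rounds, where `t` is small compared with `h`. A node in
row `0` cannot output an upward error pointer: the label of that pointer would have to be the
input bit of a node in the two topmost rows, which is out of sight (`ptrU_label_eq`,
`bottom_sol_or_ptrR`). A pointer to the right would spread along the whole row with alternating
counters, and a local rule cannot produce alternating labels, because moving a single column
changes the parity of the distance of two nodes without their noticing it
(`eq_none_of_local_of_alternating`). Hence row `0` solves the cycle problem. Every edge in these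
rows spans at most `W = 2 ^ p * g(h - 1)` columns, so a node of the cycle can simulate the
algorithm after looking `t * W` steps to both sides (`exists_rule_of_solves_grid`). By minimality
of `h`, `h * W ≤ 2 ^ (p + 1) * f(h - 1) < 2 ^ (p + 1) * T(N)`, so `t = o(h)` makes this radius
`o(T(N))` (`genInv_speedup_mul_lt`).

The time complexity `T` speaks about all lengths at once, and `nHat` need not attain all of them.
Therefore the simulation is used only for those `N` for which it applies, and the given optimal
algorithm for all others; one large `N` of the first kind then contradicts the optimality of `T`.
To find it one needs sizes at which the algorithm communicates at all, which gives `h → ∞`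
(`pos_of_solves_grid`), and the fact that the grid of width `N = nHat n` has a size with the same
`nHat` (`nHat_mul_genInv`). That the grid is wide compared with its link edges follows from
`T(N) = O(N)` (`CycleLCL.solvableInTime_id`).
-/

/-! ### Neighbourhoods under local isomorphisms -/

theorem SimpleGraph.Iso.dist_apply {V V' : Type} {G : SimpleGraph V} {G' : SimpleGraph V'}
    (φ : G ≃g G') (u v : V) : G'.dist (φ u) (φ v) = G.dist u v := by
  rw [SimpleGraph.dist_eq_sInf, SimpleGraph.dist_eq_sInf]
  congr 1
  ext n
  constructor
  · rintro ⟨p, rfl⟩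
    refine ⟨(p.map φ.symm.toHom).copy (φ.symm_apply_apply u) (φ.symm_apply_apply v), ?_⟩
    simp
  · rintro ⟨p, rfl⟩
    exact ⟨p.map φ.toHom, by simp⟩

/-- A graph isomorphism carries neighbourhoods to neighbourhoods as soon as it respects labels and
identifiers within the radius. -/
theorem LabGraph.view_eq_of_iso {σ τ V V' : Type} (I : LabGraph σ τ V) (J : LabGraph σ τ V')
    (ident : V → ℕ) (ident' : V' → ℕ) (T : ℕ) (v : V) (φ : I.graph ≃g J.graph)
    (hhalf : ∀ u w, I.graph.dist v u ≤ T → I.graph.Adj u w → J.half (φ u) (φ w) = I.half u w)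
    (hid : ∀ u, I.graph.dist v u ≤ T → ident' (φ u) = ident u ∧ J.node (φ u) = I.node u) :
    J.view ident' T (φ v) = I.view ident T v := by
  have hroot := (hid v (by simp)).1
  have hcount : ∀ u, I.graph.dist v u ≤ T → ∀ x : τ,
      {w | J.graph.Adj (φ u) w ∧ J.half (φ u) w = x}.ncard =
        {w | I.graph.Adj u w ∧ I.half u w = x}.ncard := by
    intro u hu x
    have : {w | J.graph.Adj (φ u) w ∧ J.half (φ u) w = x} =
        φ '' {w | I.graph.Adj u w ∧ I.half u w = x} := by
      ext w
      obtain ⟨w, rfl⟩ := φ.surjective w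
      simp only [Set.mem_ofPred_eq, Set.mem_image, φ.map_adj_iff]
      constructor
      · rintro ⟨h1, h2⟩
        exact ⟨w, ⟨h1, by rw [← hhalf u w hu h1, h2]⟩, rfl⟩
      · rintro ⟨w', ⟨h1, h2⟩, h3⟩
        obtain rfl := φ.injective h3
        exact ⟨h1, by rw [hhalf u _ hu h1, h2]⟩
    rw [this, Set.ncard_image_of_injective _ φ.injective]
  simp only [LabGraph.view, View.mk.injEq]
  refine ⟨hroot, ?_, ?_⟩
  · ext q
    constructor
    · rintro ⟨u, hu, rfl⟩
      obtain ⟨u, rfl⟩ := φ.surjective u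
      rw [φ.dist_apply] at hu
      refine ⟨u, hu, ?_⟩
      rw [(hid u hu).1, (hid u hu).2, funext (hcount u hu)]
    · rintro ⟨u, hu, rfl⟩
      refine ⟨φ u, by rwa [φ.dist_apply], ?_⟩
      rw [(hid u hu).1, (hid u hu).2, funext (hcount u hu)]
  · ext q
    constructor
    · rintro ⟨u, w, hu, hw, h, rfl⟩
      obtain ⟨u, rfl⟩ := φ.surjective u
      obtain ⟨w, rfl⟩ := φ.surjective w
      rw [φ.dist_apply] at hu hw
      rw [φ.map_adj_iff] at h
      exact ⟨u, w, hu, hw, h, by rw [(hid u hu).1, (hid w hw).1, hhalf u w hu h]⟩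
    · rintro ⟨u, w, hu, hw, h, rfl⟩
      exact ⟨φ u, φ w, by rwa [φ.dist_apply], by rwa [φ.dist_apply], by rwa [φ.map_adj_iff],
        by rw [(hid u hu).1, (hid w hw).1, hhalf u w hu h]⟩

/-! ### Local algorithms on directed cycles -/

/-- The standard directed cycle on `ZMod N`. -/
def cycleGraph (N : ℕ) (inp : ZMod N → Bool) : LabGraph Bool Bool (ZMod N) where
  graph := SimpleGraph.fromRel fun a b => b = a + 1
  node := inp
  half a b := decide (b = a + 1)

/-- The identifiers and inputs (stored as pairs) that `w` shows around `x` agree with those that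
`w'` shows around `x'`, up to distance `R`. -/
def WindowEq {N : ℕ} (R : ℕ) (w w' : ZMod N → ℕ × Bool) (x x' : ZMod N) : Prop :=
  ∀ d : ℤ, |d| ≤ R → w (x + d) = w' (x' + d)

/-- The first components of `w` are a legal assignment of identifiers for a cycle of length `N`. -/
def LegalIds (c : ℕ) {N : ℕ} (w : ZMod N → ℕ × Bool) : Prop :=
  Function.Injective (fun a => (w a).1) ∧ ∀ a, (w a).1 < N ^ c

theorem ZMod.one_ne_zero_of_three_le {N : ℕ} (hN : 3 ≤ N) : (1 : ZMod N) ≠ 0 := by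
  have : ((1 : ℕ) : ZMod N) ≠ 0 := by
    rw [Ne, ZMod.natCast_eq_zero_iff]
    exact fun h => by have := Nat.le_of_dvd one_pos h; omega
  simpa using this

theorem ZMod.two_ne_zero_of_three_le {N : ℕ} (hN : 3 ≤ N) : (1 + 1 : ZMod N) ≠ 0 := by
  have : ((2 : ℕ) : ZMod N) ≠ 0 := by
    rw [Ne, ZMod.natCast_eq_zero_iff]
    exact fun h => by have := Nat.le_of_dvd two_pos h; omega
  rw [one_add_one_eq_two]
  exact_mod_cast this

theorem cycleGraph_adj {N : ℕ} (hN : 3 ≤ N) (inp : ZMod N → Bool) (a b : ZMod N) :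
    (cycleGraph N inp).graph.Adj a b ↔ b = a + 1 ∨ a = b + 1 := by
  have h1 := ZMod.one_ne_zero_of_three_le hN
  simp only [cycleGraph, SimpleGraph.fromRel_adj]
  constructor
  · exact fun h => h.2
  · intro h
    refine ⟨?_, h⟩
    rintro rfl
    rcases h with h | h <;> exact h1 (by simpa using h.symm)

theorem cycleGraph_isDirectedCycle {N : ℕ} (hN : 3 ≤ N) (inp : ZMod N → Bool) :
    IsDirectedCycle (cycleGraph N inp) := by
  refine ⟨N, hN, Equiv.refl _, fun a b => cycleGraph_adj hN inp a b, fun a => ?_⟩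
  simp only [cycleGraph, Equiv.refl_apply, decide_true, decide_eq_false_iff_not, true_and]
  intro h
  exact ZMod.two_ne_zero_of_three_le hN (by rw [add_assoc] at h; simpa using h.symm)

theorem cycleGraph_exists_walk {N : ℕ} (hN : 3 ≤ N) (inp : ZMod N → Bool) (x : ZMod N) (n : ℕ) :
    (∃ p : (cycleGraph N inp).graph.Walk x (x + n), p.length = n) ∧
      ∃ p : (cycleGraph N inp).graph.Walk x (x - n), p.length = n := by
  induction n with
  | zero => exact ⟨⟨SimpleGraph.Walk.nil.copy rfl (by simp), by simp⟩,
      ⟨SimpleGraph.Walk.nil.copy rfl (by simp), by simp⟩⟩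
  | succ n ih =>
    obtain ⟨⟨p, hp⟩, q, hq⟩ := ih
    refine ⟨⟨p.concat ((cycleGraph_adj hN inp _ _).2 (Or.inl ?_)), ?_⟩,
      ⟨q.concat ((cycleGraph_adj hN inp _ _).2 (Or.inr ?_)), ?_⟩⟩
    · push_cast; ring
    · rw [SimpleGraph.Walk.length_concat, hp]
    · push_cast; ring
    · rw [SimpleGraph.Walk.length_concat, hq]

theorem cycleGraph_dist_le {N : ℕ} (hN : 3 ≤ N) (inp : ZMod N → Bool) (x : ZMod N) (d : ℤ) :
    ((cycleGraph N inp).graph.dist x (x + d) : ℤ) ≤ |d| := by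
  obtain ⟨n, rfl | rfl⟩ := d.eq_nat_or_neg
  · obtain ⟨p, hp⟩ := (cycleGraph_exists_walk hN inp x n).1
    have := SimpleGraph.dist_le p
    rw [hp] at this
    simpa using this
  · obtain ⟨p, hp⟩ := (cycleGraph_exists_walk hN inp x n).2
    have := SimpleGraph.dist_le p
    rw [hp] at this
    simpa [← sub_eq_add_neg] using this

theorem cycleGraph_connected {N : ℕ} (hN : 3 ≤ N) (inp : ZMod N → Bool) :
    (cycleGraph N inp).graph.Connected := by
  have : NeZero N := ⟨by omega⟩
  refine ⟨fun a b => ?_⟩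
  obtain ⟨p, -⟩ := (cycleGraph_exists_walk hN inp a (b - a).val).1
  exact ⟨p.copy rfl (by simp)⟩

theorem cycleGraph_walk_displacement {N : ℕ} (hN : 3 ≤ N) (inp : ZMod N → Bool) {x u : ZMod N}
    (p : (cycleGraph N inp).graph.Walk x u) : ∃ d : ℤ, |d| ≤ p.length ∧ u = x + d := by
  induction p with
  | nil => exact ⟨0, by simp⟩
  | cons h p ih =>
    obtain ⟨d, hd, rfl⟩ := ih
    rw [abs_le] at hd
    rw [SimpleGraph.Walk.length_cons]
    rcases (cycleGraph_adj hN inp _ _).1 h with h | h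
    · exact ⟨d + 1, by rw [abs_le]; push_cast; constructor <;> linarith, by
        rw [h]; push_cast; ring⟩
    · exact ⟨d - 1, by rw [abs_le]; push_cast; constructor <;> linarith, by
        rw [h]; push_cast; ring⟩

/-- The radius-`R` neighbourhood of a node of a directed cycle determines the window of
radius `R` around the node: read off the labels one by one along the cycle. -/
theorem windowEq_of_view_eq {N R : ℕ} (hN : 3 ≤ N) {w w' : ZMod N → ℕ × Bool} {x x' : ZMod N}
    (hinj : Function.Injective fun a => (w' a).1)
    (h : (cycleGraph N fun a => (w a).2).view (fun a => (w a).1) R x =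
      (cycleGraph N fun a => (w' a).2).view (fun a => (w' a).1) R x') : WindowEq R w w' x x' := by
  simp only [LabGraph.view, View.mk.injEq] at h
  obtain ⟨hroot, hnodes, hedges⟩ := h
  set I := cycleGraph N fun a => (w a).2 with hI
  set J := cycleGraph N fun a => (w' a).2 with hJ
  -- a directed edge in the first view is a directed edge in the second view
  have hedge : ∀ a b : ZMod N, b = a + 1 → I.graph.dist x a ≤ R → I.graph.dist x b ≤ R →
      ∃ a' : ZMod N, (w' a').1 = (w a).1 ∧ (w' (a' + 1)).1 = (w b).1 := by
    rintro a b hb ha hb'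
    have hmem : ((w a).1, (w b).1, true) ∈ {q | ∃ u v, I.graph.dist x u ≤ R ∧
        I.graph.dist x v ≤ R ∧ I.graph.Adj u v ∧ q = ((w u).1, (w v).1, I.half u v)} :=
      ⟨a, b, ha, hb', (cycleGraph_adj hN _ _ _).2 (Or.inl hb), by simp [hI, cycleGraph, hb]⟩
    rw [hedges] at hmem
    obtain ⟨u, v, -, -, -, h⟩ := hmem
    simp only [Prod.mk.injEq, hJ, cycleGraph, eq_comm (a := true), decide_eq_true_eq] at h
    exact ⟨u, h.1.symm, by rw [← h.2.2]; exact h.2.1.symm⟩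
  have hid : ∀ n : ℕ, n ≤ R → (w (x + n)).1 = (w' (x' + n)).1 ∧
      (w (x - n)).1 = (w' (x' - n)).1 := by
    intro n
    induction n with
    | zero => intro _; simpa using hroot
    | succ n ih =>
      intro hn
      have hpos : ∀ k : ℕ, k ≤ R → I.graph.dist x (x + k) ≤ R := fun k hk => by
        have := cycleGraph_dist_le hN (fun a => (w a).2) x k
        simp only [Int.cast_natCast, Nat.abs_cast, Nat.cast_le] at this
        exact this.trans hk
      have hneg : ∀ k : ℕ, k ≤ R → I.graph.dist x (x - k) ≤ R := fun k hk => by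
        have := cycleGraph_dist_le hN (fun a => (w a).2) x (-k)
        simp only [Int.cast_neg, Int.cast_natCast, abs_neg, Nat.abs_cast, Nat.cast_le,
          ← sub_eq_add_neg] at this
        exact this.trans hk
      obtain ⟨h1, h2⟩ := ih (by omega)
      constructor
      · obtain ⟨a', ha, hb⟩ := hedge (x + n) (x + (n + 1 : ℕ)) (by push_cast; ring)
          (hpos _ (by omega)) (hpos _ hn)
        obtain rfl : a' = x' + n := hinj (ha.trans h1)
        rw [← hb]
        congr 2
        push_cast; ring
      · obtain ⟨a', ha, hb⟩ := hedge (x - (n + 1 : ℕ)) (x - n) (by push_cast; ring)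
          (hneg _ hn) (hneg _ (by omega))
        have : a' + 1 = x' - n := hinj (hb.trans h2)
        obtain rfl : a' = x' - (n + 1 : ℕ) := by
          rw [eq_sub_of_add_eq this]; push_cast; ring
        exact ha.symm
  intro d hd
  have hid' : (w (x + d)).1 = (w' (x' + d)).1 := by
    obtain ⟨n, rfl | rfl⟩ := d.eq_nat_or_neg
    · simpa using (hid n (by simpa using hd)).1
    · simpa [← sub_eq_add_neg] using (hid n (by simpa using hd)).2
  refine Prod.ext hid' ?_
  have hdist : I.graph.dist x (x + d) ≤ R := by
    have := (cycleGraph_dist_le hN (fun a => (w a).2) x d).trans hd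
    exact_mod_cast this
  have hmem := Set.ext_iff.1 hnodes ((w (x + d)).1, (w (x + d)).2,
    fun y => {v | I.graph.Adj (x + d) v ∧ I.half (x + d) v = y}.ncard)
  obtain ⟨u, -, hu⟩ := hmem.1 ⟨x + d, hdist, rfl⟩
  simp only [Prod.mk.injEq] at hu
  obtain rfl : u = x' + d := hinj (hu.1.symm.trans hid')
  exact hu.2.1

/-- Rotation of the standard cycle. -/
def cycleRotation {N : ℕ} (inp inp' : ZMod N → Bool) (s : ZMod N) :
    (cycleGraph N inp).graph ≃g (cycleGraph N inp').graph where
  toEquiv := Equiv.addRight s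
  map_rel_iff' {a b} := by
    simp only [cycleGraph, SimpleGraph.fromRel_adj, Equiv.coe_addRight, ne_eq, add_left_inj,
      add_right_comm _ s 1]

theorem view_eq_of_windowEq {N R : ℕ} (hN : 3 ≤ N) {w w' : ZMod N → ℕ × Bool} {x x' : ZMod N}
    (h : WindowEq R w w' x x') :
    (cycleGraph N fun a => (w' a).2).view (fun a => (w' a).1) R x' =
      (cycleGraph N fun a => (w a).2).view (fun a => (w a).1) R x := by
  have := LabGraph.view_eq_of_iso (cycleGraph N fun a => (w a).2) (cycleGraph N fun a => (w' a).2)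
    (fun a => (w a).1) (fun a => (w' a).1) R x (cycleRotation _ _ (x' - x)) ?_ ?_
  · rw [← this]
    congr 1
    simp [cycleRotation]
  · intro u v _ _
    change decide (v + (x' - x) = u + (x' - x) + 1) = decide (v = u + 1)
    rw [decide_eq_decide, add_right_comm, add_left_inj]
  · intro u hu
    obtain ⟨p, hp⟩ := (cycleGraph_connected hN fun a => (w a).2).exists_walk_length_eq_dist x u
    obtain ⟨d, hd, rfl⟩ := cycleGraph_walk_displacement hN _ p
    have := h d (hd.trans (by rw [hp]; exact_mod_cast hu))
    have e : cycleRotation (fun a => (w a).2) (fun a => (w' a).2) (x' - x) (x + d) = x' + d := by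
      simp only [cycleRotation, RelIso.coe_fn_mk, Equiv.coe_addRight]
      ring
    rw [e, this]
    exact ⟨rfl, congrArg Prod.snd this.symm⟩

/-- A rule that labels every standard cycle correctly and looks only at windows of radius `t N` is
a `t`-round algorithm for all directed cycles. -/
theorem CycleLCL.solvableInTime_of_local {Γ : Type} (P : CycleLCL Γ) (c : ℕ) (t : ℕ → ℕ)
    (F : ∀ N, (ZMod N → ℕ × Bool) → ZMod N → Γ)
    (hloc : ∀ N, 3 ≤ N → ∀ w w' x x', LegalIds c w → LegalIds c w' →
      WindowEq (t N) w w' x x' → F N w x = F N w' x')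
    (hval : ∀ N, 3 ≤ N → ∀ w, LegalIds c w → ∀ v, P.ConstraintsAt (fun a b => b = a + 1)
      (fun a => (w a).2) (fun a y => F N w a = y) v) : P.problem.SolvableInTime c t := by
  classical
  refine ⟨fun N V => if h : ∃ q : (ZMod N → ℕ × Bool) × ZMod N, LegalIds c q.1 ∧
    V = (cycleGraph N fun a => (q.1 a).2).view (fun a => (q.1 a).1) (t N) q.2
    then F N h.choose.1 h.choose.2 else F 0 (fun _ => (0, false)) 0, ?_⟩
  rintro V _ I ⟨N, hN, e, hadj, hhalf⟩ ident hinj hlt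
  have : NeZero N := ⟨by omega⟩
  have hcard : Fintype.card V = N := by rw [← Fintype.card_congr e, ZMod.card]
  rw [hcard] at hlt ⊢
  set w : ZMod N → ℕ × Bool := fun a => (ident (e a), I.node (e a)) with hw
  have hlegal : LegalIds c w := ⟨hinj.comp e.injective, fun a => hlt _⟩
  have hsucc : ∀ a b : ZMod N, (I.graph.Adj (e a) (e b) ∧ I.half (e a) (e b) = true) ↔
      b = a + 1 := by
    intro a b
    constructor
    · rintro ⟨h1, h2⟩
      rcases (hadj a b).1 h1 with h | h
      · exact h
      · rw [h, (hhalf b).2] at h2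
        exact absurd h2 (by simp)
    · rintro rfl
      exact ⟨(hadj _ _).2 (Or.inl rfl), (hhalf a).1⟩
  have hview : ∀ a : ZMod N, I.view ident (t N) (e a) =
      (cycleGraph N fun a => (w a).2).view (fun a => (w a).1) (t N) a := by
    intro a
    refine LabGraph.view_eq_of_iso (cycleGraph N fun a => (w a).2) I _ _ _ a
      ⟨e, fun {a b} => by rw [hadj, cycleGraph_adj hN]⟩ ?_ fun u _ => ⟨rfl, rfl⟩
    intro u v _ huv
    change I.half (e u) (e v) = decide (v = u + 1)
    rw [Bool.eq_iff_iff, decide_eq_true_eq, ← hsucc u v]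
    rw [cycleGraph_adj hN, ← hadj] at huv
    exact (and_iff_right huv).symm
  have hout : ∀ a : ZMod N, (fun V => if h : ∃ q : (ZMod N → ℕ × Bool) × ZMod N, LegalIds c q.1 ∧
      V = (cycleGraph N fun a => (q.1 a).2).view (fun a => (q.1 a).1) (t N) q.2
      then F N h.choose.1 h.choose.2 else F 0 (fun _ => (0, false)) 0)
      (I.view ident (t N) (e a)) = F N w a := by
    intro a
    have hex : ∃ q : (ZMod N → ℕ × Bool) × ZMod N, LegalIds c q.1 ∧ I.view ident (t N) (e a) =
        (cycleGraph N fun a => (q.1 a).2).view (fun a => (q.1 a).1) (t N) q.2 :=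
      ⟨(w, a), hlegal, hview a⟩
    beta_reduce
    rw [dif_pos hex]
    obtain ⟨h1, h2⟩ := hex.choose_spec
    exact hloc N hN _ _ _ _ h1 hlegal
      (windowEq_of_view_eq hN hlegal.1 (h2.symm.trans (hview a)))
  intro v j hj u y hu hnext hy
  have hy' : ∀ i, F N w (e.symm (u i)) = y i := fun i => by
    have := hout (e.symm (u i))
    rw [e.apply_symm_apply] at this
    exact this.symm.trans (hy i)
  have key := hval N hN w hlegal (e.symm v) j hj (fun i => e.symm (u i)) y (by simp [hu])
    (fun i => (hsucc _ _).1 (by simpa using hnext i)) hy'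
  simpa [hw] using key

/-- A cycle algorithm read as a rule on the standard cycles looks only at windows. -/
theorem CycleLCL.exists_local_rule {Γ : Type} (P : CycleLCL Γ) {c : ℕ} {T : ℕ → ℕ}
    (h : P.problem.SolvableInTime c T) : ∃ F : ∀ N, (ZMod N → ℕ × Bool) → ZMod N → Γ,
    (∀ N, 3 ≤ N → ∀ w w' x x', WindowEq (T N) w w' x x' → F N w x = F N w' x') ∧
    (∀ N, 3 ≤ N → ∀ w, LegalIds c w → ∀ v, P.ConstraintsAt (fun a b => b = a + 1)
      (fun a => (w a).2) (fun a y => F N w a = y) v) := by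
  obtain ⟨A, hA⟩ := h
  refine ⟨fun N w x => A N ((cycleGraph N fun a => (w a).2).view (fun a => (w a).1) (T N) x),
    fun N hN w w' x x' hw => by beta_reduce; rw [view_eq_of_windowEq hN hw], fun N hN w hw v => ?_⟩
  have : NeZero N := ⟨by omega⟩
  have := hA (ZMod N) (cycleGraph N fun a => (w a).2) (cycleGraph_isDirectedCycle hN _)
    (fun a => (w a).1) hw.1 (by rw [ZMod.card]; exact hw.2)
  rw [ZMod.card] at this
  intro j hj u y hu hnext hy
  refine this v j hj u y hu (fun i => ⟨(cycleGraph_adj hN _ _ _).2 (Or.inl (hnext i)), ?_⟩) hy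
  simp [cycleGraph, hnext i]

/-- Within `N` rounds every node sees its whole cycle, so a solvable problem is solvable
in time `N`. -/
theorem CycleLCL.solvableInTime_id {Γ : Type} (P : CycleLCL Γ) {c : ℕ} {T : ℕ → ℕ}
    (h : P.problem.SolvableInTime c T) : P.problem.SolvableInTime c id := by
  obtain ⟨F, hloc, hval⟩ := P.exists_local_rule h
  refine P.solvableInTime_of_local c _ F (fun N hN w w' x x' _ _ hw => ?_) hval
  have : NeZero N := ⟨by omega⟩
  refine hloc N hN w w' x x' fun d _ => ?_
  have := hw ((d : ZMod N).val : ℤ) (by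
    rw [Nat.abs_cast]
    exact_mod_cast (ZMod.val_lt (d : ZMod N)).le)
  simpa using this

/-! ### Register values during an execution -/

namespace LinkMachine

/-- The state of the machine in the execution with index `y`, after its first `i` instructions. -/
def midState (M : LinkMachine) (y i : ℕ) : (Fin M.k → ℕ) × ℕ :=
  (M.prog.take i).foldl Instr.step (M.regs y, 0)

/-- The length of the link edges labelled `(r, i)` in row `y`: the value of register `r` after
the first `i` instructions of the execution with index `y`. -/
def linkLen (M : LinkMachine) (y : ℕ) (r : Fin M.k) (i : ℕ) : ℕ := (M.midState y i).1 r

theorem midState_succ (M : LinkMachine) (y : ℕ) {i : ℕ} (hi : i < M.prog.length) :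
    M.midState y (i + 1) = Instr.step (M.midState y i) M.prog[i] := by
  rw [midState, midState, List.take_succ_eq_append_getElem hi, List.foldl_append]
  rfl

theorem linkLen_zero (M : LinkMachine) (y : ℕ) (r : Fin M.k) : M.linkLen y r 0 = M.regs y r := rfl

theorem linkLen_p (M : LinkMachine) (y : ℕ) (r : Fin M.k) :
    M.linkLen y r M.p = M.linkLen (y + 1) r 0 := by
  rw [linkLen_zero, regs, Function.iterate_succ_apply', linkLen, midState, p, List.take_length]
  rfl

theorem foldl_step_bounds {k : ℕ} (l : List (Instr k)) :
    ∀ (q : (Fin k → ℕ) × ℕ) (B : ℕ), (∀ r, 1 ≤ q.1 r) → (∀ r, q.1 r ≤ B) →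
      (∀ r, 1 ≤ (l.foldl Instr.step q).1 r) ∧
        ∀ r, (l.foldl Instr.step q).1 r ≤ 2 ^ l.length * B := by
  induction l with
  | nil => intro q B h1 h2; exact ⟨h1, by simpa using h2⟩
  | cons ins l ih =>
    intro q B h1 h2
    have key : (∀ r, 1 ≤ (Instr.step q ins).1 r) ∧ ∀ r, (Instr.step q ins).1 r ≤ 2 * B := by
      obtain ⟨f, d⟩ := q
      have h3 : ∀ r, f r ≤ 2 * B := fun r => (h2 r).trans (by omega)
      have h4 : ∀ r, 1 ≤ B := fun r => (h1 r).trans (h2 r)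
      cases d with
      | succ d => exact ⟨h1, h3⟩
      | zero =>
        cases ins with
        | add a b c =>
          constructor <;> intro r <;> by_cases hr : r = a
          · subst hr; simpa [Instr.step] using Nat.le_add_right_of_le (h1 b)
          · simpa [Instr.step, hr] using h1 r
          · subst hr
            have := h2 b
            have := h2 c
            simp only [Instr.step, Function.update_self]
            simp only at *
            omega
          · simpa [Instr.step, hr] using h3 r
        | reset a =>
          constructor <;> intro r <;> by_cases hr : r = a
          · subst hr; simp [Instr.step]
          · simpa [Instr.step, hr] using h1 r
          · subst hr
            have := h4 r
            simp only [Instr.step, Function.update_self]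
            omega
          · simpa [Instr.step, hr] using h3 r
        | ifEq a b s => exact ⟨h1, h3⟩
        | ifNe a b s => exact ⟨h1, h3⟩
    have := ih (Instr.step q ins) (2 * B) key.1 key.2
    rw [List.foldl_cons, List.length_cons, pow_succ, mul_assoc]
    exact this

theorem one_le_regs (M : LinkMachine) (y : ℕ) (r : Fin M.k) : 1 ≤ M.regs y r := by
  induction y generalizing r with
  | zero => exact le_rfl
  | succ y ih =>
    rw [regs, Function.iterate_succ_apply']
    exact (foldl_step_bounds M.prog (M.regs y, 0) (M.growth y) ih
      (fun r => Finset.le_sup (Finset.mem_univ r))).1 r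

theorem one_le_linkLen (M : LinkMachine) (y : ℕ) (r : Fin M.k) (i : ℕ) : 1 ≤ M.linkLen y r i :=
  (foldl_step_bounds (M.prog.take i) (M.regs y, 0) (M.growth y) (M.one_le_regs y)
    (fun r => Finset.le_sup (Finset.mem_univ r))).1 r

/-- Every instruction at most doubles the maximum register value. -/
theorem linkLen_le (M : LinkMachine) (y : ℕ) (r : Fin M.k) (i : ℕ) :
    M.linkLen y r i ≤ 2 ^ M.p * M.growth y := by
  refine ((foldl_step_bounds (M.prog.take i) (M.regs y, 0) (M.growth y) (M.one_le_regs y)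
    (fun r => Finset.le_sup (Finset.mem_univ r))).2 r).trans (Nat.mul_le_mul_right _ ?_)
  exact Nat.pow_le_pow_right two_pos (by rw [List.length_take, p]; exact min_le_right _ _)

end LinkMachine

/-! ### Link machine encoding graphs over a cycle -/

/-- `GridRel x v u`: in the grid with columns `ZMod N` and rows `0, …, h - 1` the label `x` leads
from `v` to `u`. Columns wrap around, rows do not, and a link edge leads to the right
by the corresponding register value. -/
def GridRel (M : LinkMachine) (N h : ℕ) : EdgeLabel M → ZMod N × Fin h → ZMod N × Fin h → Prop
  | .dir .U, v, u => u.1 = v.1 ∧ (u.2 : ℕ) = v.2 + 1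
  | .dir .D, v, u => u.1 = v.1 ∧ (u.2 : ℕ) + 1 = v.2
  | .dir .L, v, u => u.1 = v.1 - 1 ∧ u.2 = v.2
  | .dir .R, v, u => u.1 = v.1 + 1 ∧ u.2 = v.2
  | .link r i, v, u => u.1 = v.1 + (M.linkLen v.2 r i : ZMod N) ∧ u.2 = v.2

/-- The link machine encoding graph with `N` columns, joined to a cycle, and `h` rows. -/
def gridGraph (M : LinkMachine) (N h : ℕ) (inp : ZMod N × Fin h → Bool) :
    EncGraph M (ZMod N × Fin h) where
  graph := SimpleGraph.fromRel fun v u => ∃ x, GridRel M N h x v u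
  node := inp
  half v u := {x | GridRel M N h x v u}

theorem GridRel.unique {M : LinkMachine} {N h : ℕ} {x : EdgeLabel M} {v u u' : ZMod N × Fin h}
    (h1 : GridRel M N h x v u) (h2 : GridRel M N h x v u') : u = u' := by
  rcases x with (_ | _ | _ | _) | ⟨r, i⟩ <;>
    exact Prod.ext (h1.1.trans h2.1.symm) (Fin.ext (by have := h1.2; have := h2.2; omega))

section Grid

variable {M : LinkMachine} {N h : ℕ} (hN : 3 ≤ N)
  (hW : ∀ y < h, ∀ r i, M.linkLen y r i < N) (inp : ZMod N × Fin h → Bool)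

include hN hW

theorem GridRel.ne {x : EdgeLabel M} {v u : ZMod N × Fin h} (hr : GridRel M N h x v u) :
    v ≠ u := by
  rintro rfl
  have h1 := ZMod.one_ne_zero_of_three_le hN
  rcases x with (_ | _ | _ | _) | ⟨r, i⟩
  · have := hr.2; omega
  · have := hr.2; omega
  · exact h1 (by simpa [eq_sub_iff_add_eq] using hr.1)
  · exact h1 (by simpa using hr.1)
  · have h2 : (M.linkLen v.2 r i : ZMod N) = 0 := by simpa using hr.1
    rw [ZMod.natCast_eq_zero_iff] at h2
    have := Nat.le_of_dvd (M.one_le_linkLen _ _ _) h2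
    have := hW v.2 v.2.2 r i
    omega

theorem gridGraph_adj (v u : ZMod N × Fin h) : (gridGraph M N h inp).graph.Adj v u ↔
    ∃ x, GridRel M N h x v u ∨ GridRel M N h x u v := by
  simp only [gridGraph, SimpleGraph.fromRel_adj, exists_or]
  refine and_iff_right_of_imp ?_
  rintro (⟨x, hx⟩ | ⟨x, hx⟩)
  · exact hx.ne hN hW
  · exact (hx.ne hN hW).symm

theorem gridGraph_step (x : EdgeLabel M) (v u : ZMod N × Fin h) :
    (gridGraph M N h inp).Step x v u ↔ GridRel M N h x v u := by
  rw [EncGraph.Step, gridGraph_adj hN hW inp]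
  exact ⟨fun h => h.2, fun h => ⟨⟨x, Or.inl h⟩, h⟩⟩

theorem gridGraph_exists_walk_right (x : ZMod N) (y : Fin h) (n : ℕ) :
    (gridGraph M N h inp).graph.Reachable (x, y) (x + n, y) := by
  induction n with
  | zero => simp
  | succ n ih =>
    refine ih.trans (SimpleGraph.Adj.reachable ((gridGraph_adj hN hW inp _ _).2
      ⟨.dir .R, Or.inl ⟨?_, rfl⟩⟩))
    push_cast; ring

theorem gridGraph_connected (hh : 0 < h) : (gridGraph M N h inp).graph.Connected := by
  have : NeZero N := ⟨by omega⟩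
  have hdown : ∀ y (hy : y < h) (x : ZMod N),
      (gridGraph M N h inp).graph.Reachable (x, ⟨y, hy⟩) (x, ⟨0, hh⟩) := by
    intro y
    induction y with
    | zero => intro _ _; rfl
    | succ y ih =>
      intro hy x
      have hadj := (gridGraph_adj hN hW inp (x, ⟨y + 1, hy⟩) (x, ⟨y, by omega⟩)).2
        ⟨.dir .D, Or.inl ⟨rfl, rfl⟩⟩
      exact hadj.reachable.trans (ih (by omega) x)
  have hbase : ∀ v, (gridGraph M N h inp).graph.Reachable (0, ⟨0, hh⟩) v := by
    rintro ⟨x, y, hy⟩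
    refine SimpleGraph.Reachable.trans ?_ (hdown y hy x).symm
    simpa using gridGraph_exists_walk_right hN hW inp 0 ⟨0, hh⟩ x.val
  have : Nonempty (ZMod N × Fin h) := ⟨(0, ⟨0, hh⟩)⟩
  exact ⟨fun u v => (hbase u).symm.trans (hbase v)⟩

/-- The degree bound: four grid edges, and for each link label one outgoing and one
incoming edge. -/
theorem gridGraph_degree (v : ZMod N × Fin h) :
    ((gridGraph M N h inp).graph.neighborSet v).ncard ≤ 2 * M.k * (M.p + 1) + 4 := by
  classical
  let nb : Fin 4 ⊕ (Fin M.k × Fin (M.p + 1)) ⊕ (Fin M.k × Fin (M.p + 1)) →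
      Set (ZMod N × Fin h)
    | .inl d => {u | GridRel M N h (.dir (![.U, .D, .L, .R] d)) v u}
    | .inr (.inl q) => {u | GridRel M N h (.link q.1 q.2) v u}
    | .inr (.inr q) => {u | GridRel M N h (.link q.1 q.2) u v}
  have hsub : (gridGraph M N h inp).graph.neighborSet v ⊆ ⋃ q, nb q := by
    intro u hu
    rw [Set.mem_iUnion]
    obtain ⟨x, hx⟩ := (gridGraph_adj hN hW inp v u).1 hu
    rcases x with d | ⟨r, i⟩
    · rcases hx with hx | hx
      · cases d
        · exact ⟨.inl 0, hx⟩
        · exact ⟨.inl 1, hx⟩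
        · exact ⟨.inl 2, hx⟩
        · exact ⟨.inl 3, hx⟩
      · cases d
        · exact ⟨.inl 1, hx.1.symm, hx.2.symm⟩
        · exact ⟨.inl 0, hx.1.symm, hx.2.symm⟩
        · exact ⟨.inl 3, by rw [hx.1]; ring, hx.2.symm⟩
        · exact ⟨.inl 2, by rw [hx.1]; ring, hx.2.symm⟩
    · rcases hx with hx | hx
      · exact ⟨.inr (.inl (r, i)), hx⟩
      · exact ⟨.inr (.inr (r, i)), hx⟩
  have hone : ∀ q, (nb q).encard ≤ 1 := by
    intro q
    rw [Set.encard_le_one_iff]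
    rcases q with d | q | q
    · exact fun a b ha hb => GridRel.unique (x := .dir _) (v := v) ha hb
    · exact fun a b ha hb => GridRel.unique (x := .link q.1 q.2) (v := v) ha hb
    · intro a b ha hb
      have h2 : a.2 = b.2 := ha.2.symm.trans hb.2
      refine Prod.ext ?_ h2
      have := ha.1.symm.trans hb.1
      rwa [h2, add_left_inj] at this
  have hcard : (⋃ q, nb q).encard ≤ (2 * M.k * (M.p + 1) + 4 : ℕ) := by
    refine (Set.encard_iUnion_le_of_fintype nb).trans ?_
    refine (Finset.sum_le_sum fun q _ => hone q).trans ?_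
    simp only [Finset.sum_const, Finset.card_univ, Fintype.card_sum, Fintype.card_prod,
      Fintype.card_fin, nsmul_eq_mul, mul_one, Nat.cast_le]
    ring_nf
    exact le_rfl
  have hle := (Set.encard_le_encard hsub).trans hcard
  rw [Set.ncard]
  exact ENat.toNat_le_of_le_natCast hle

end Grid

/-! ### Local constraints below the top row -/

section LocalConstraints

variable {M : LinkMachine} {N h : ℕ} (hN : 3 ≤ N)
  (hW : ∀ y < h, ∀ r i, M.linkLen y r i < N) (inp : ZMod N × Fin h → Bool)

include hN hW

theorem gridGraph_leadsTo_cons {x : EdgeLabel M} {xs : List (EdgeLabel M)}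
    {v w u : ZMod N × Fin h} (hx : GridRel M N h x v w)
    (hxs : (gridGraph M N h inp).LeadsTo xs w u) : (gridGraph M N h inp).LeadsTo (x :: xs) v u := by
  intro a
  rw [← hxs a]
  constructor
  · rintro ⟨w', h1, h2⟩
    rw [gridGraph_step hN hW] at h1
    rwa [hx.unique h1]
  · exact fun h => ⟨w, (gridGraph_step hN hW inp _ _ _).2 hx, h⟩

omit hN hW in
theorem gridGraph_leadsTo_nil (v : ZMod N × Fin h) : (gridGraph M N h inp).LeadsTo [] v v :=
  fun _ => eq_comm

theorem gridGraph_sameEdge (x y : EdgeLabel M) (v : ZMod N × Fin h) :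
    (gridGraph M N h inp).SameEdge x y v ↔ ∃ u, GridRel M N h x v u ∧ GridRel M N h y v u := by
  simp only [EncGraph.SameEdge, gridGraph_step hN hW]

theorem gridGraph_has (x : EdgeLabel M) (v : ZMod N × Fin h) :
    (gridGraph M N h inp).Has x v ↔ ∃ u, GridRel M N h x v u := by
  simp only [EncGraph.Has, gridGraph_step hN hW]

omit hN hW in
theorem gridRel_lk {i : ℕ} (hi : i ≤ M.p) (r : Fin M.k) (v u : ZMod N × Fin h) :
    GridRel M N h (M.lk r i) v u ↔ u = (v.1 + (M.linkLen v.2 r i : ZMod N), v.2) := by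
  have : ((Fin.ofNat (M.p + 1) i : Fin (M.p + 1)) : ℕ) = i := Nat.mod_eq_of_lt (by omega)
  simp only [LinkMachine.lk, GridRel, this, Prod.ext_iff]

theorem gridGraph_sameEdge_lk {i j : ℕ} (hi : i ≤ M.p) (hj : j ≤ M.p) (a b : Fin M.k)
    (v : ZMod N × Fin h) : (gridGraph M N h inp).SameEdge (M.lk a i) (M.lk b j) v ↔
      M.linkLen v.2 a i = M.linkLen v.2 b j := by
  simp only [gridGraph_sameEdge hN hW, gridRel_lk hi, gridRel_lk hj, exists_eq_left, Prod.mk.injEq,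
    add_right_inj, and_true]
  rw [ZMod.natCast_eq_natCast_iff', Nat.mod_eq_of_lt (hW _ v.2.2 _ _),
    Nat.mod_eq_of_lt (hW _ v.2.2 _ _)]

theorem gridGraph_sameEdge_right {i : ℕ} (hi : i ≤ M.p) {a : Fin M.k} {v : ZMod N × Fin h}
    (hone : M.linkLen v.2 a i = 1) :
    (gridGraph M N h inp).SameEdge (.dir .R) (M.lk a i) v := by
  rw [gridGraph_sameEdge hN hW]
  exact ⟨(v.1 + 1, v.2), ⟨rfl, rfl⟩, (gridRel_lk hi _ _ _).2 (by rw [hone, Nat.cast_one])⟩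

theorem gridGraph_has_U (v : ZMod N × Fin h) :
    (gridGraph M N h inp).Has (.dir .U) v ↔ (v.2 : ℕ) + 1 < h := by
  rw [gridGraph_has hN hW]
  constructor
  · rintro ⟨u, hu⟩
    have := u.2.2
    have := hu.2
    omega
  · exact fun hv => ⟨(v.1, ⟨v.2 + 1, hv⟩), rfl, rfl⟩

theorem gridGraph_has_D (v : ZMod N × Fin h) :
    (gridGraph M N h inp).Has (.dir .D) v ↔ 0 < (v.2 : ℕ) := by
  rw [gridGraph_has hN hW]
  constructor
  · rintro ⟨u, hu⟩
    have := hu.2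
    omega
  · intro hv
    have := v.2.2
    exact ⟨(v.1, ⟨v.2 - 1, by omega⟩), rfl, by dsimp only; omega⟩

theorem gridGraph_basic (hh : 2 ≤ h) (v : ZMod N × Fin h) : (gridGraph M N h inp).Basic v := by
  have hone := ZMod.one_ne_zero_of_three_le hN
  have htwo := ZMod.two_ne_zero_of_three_le hN
  refine ⟨fun r i => ?_, ?_, ?_, ?_, ?_, ?_, ?_⟩
  · exact ⟨(v.1 + (M.linkLen v.2 r i : ZMod N), v.2), (gridGraph_step hN hW ..).2 ⟨rfl, rfl⟩,
      fun u hu => ((gridGraph_step hN hW ..).1 hu).unique ⟨rfl, rfl⟩⟩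
  · exact ⟨(v.1 - 1, v.2), (gridGraph_step hN hW ..).2 ⟨rfl, rfl⟩,
      fun u hu => ((gridGraph_step hN hW ..).1 hu).unique ⟨rfl, rfl⟩⟩
  · exact ⟨(v.1 + 1, v.2), (gridGraph_step hN hW ..).2 ⟨rfl, rfl⟩,
      fun u hu => ((gridGraph_step hN hW ..).1 hu).unique ⟨rfl, rfl⟩⟩
  · exact fun u w hu hw => ((gridGraph_step hN hW ..).1 hu).unique ((gridGraph_step hN hW ..).1 hw)
  · exact fun u w hu hw => ((gridGraph_step hN hW ..).1 hu).unique ((gridGraph_step hN hW ..).1 hw)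
  · rw [gridGraph_has_U hN hW, gridGraph_has_D hN hW]
    omega
  · intro d d' hne hs
    obtain ⟨u, h1, h2⟩ := (gridGraph_sameEdge hN hW ..).1 hs
    have hLR : ∀ u : ZMod N × Fin h, GridRel M N h (.dir .L) v u → GridRel M N h (.dir .R) v u →
        False := by
      intro u h1 h2
      have := h2.1.symm.trans h1.1
      rw [eq_sub_iff_add_eq, add_assoc] at this
      exact htwo (by simpa using this)
    cases d <;> cases d' <;> first
      | exact hne rfl
      | exact hLR u h1 h2
      | exact hLR u h2 h1
      | (have := h1.2; have := h2.2; omega)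

theorem gridGraph_grid (v : ZMod N × Fin h) : (gridGraph M N h inp).Grid v := by
  refine ⟨?_, ?_, ?_, ?_⟩
  · intro d u hu
    rw [gridGraph_step hN hW] at hu ⊢
    cases d
    · exact ⟨hu.1.symm, hu.2.symm⟩
    · exact ⟨hu.1.symm, hu.2.symm⟩
    · exact ⟨by rw [hu.1]; ring, hu.2.symm⟩
    · exact ⟨by rw [hu.1]; ring, hu.2.symm⟩
  · intro hD
    obtain ⟨u, hu⟩ := (gridGraph_has hN hW ..).1 hD
    refine ⟨(v.1 + 1, v.2), ?_, ?_⟩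
    · refine gridGraph_leadsTo_cons hN hW inp hu (gridGraph_leadsTo_cons hN hW inp
        (w := (u.1 + 1, u.2)) ⟨rfl, rfl⟩ (gridGraph_leadsTo_cons hN hW inp
          (w := (v.1 + 1, v.2)) ⟨?_, hu.2.symm⟩ (gridGraph_leadsTo_nil inp _)))
      change v.1 + 1 = u.1 + 1
      rw [hu.1]
    · exact gridGraph_leadsTo_cons hN hW inp (w := (v.1 + 1, v.2)) ⟨rfl, rfl⟩
        (gridGraph_leadsTo_nil inp _)
  · intro hD u hu
    rw [gridGraph_has_D hN hW] at hD ⊢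
    simp only [gridGraph_step hN hW] at hu
    rcases hu with hu | hu <;> rwa [hu.2]
  · intro hU u hu
    rw [gridGraph_has_U hN hW] at hU ⊢
    simp only [gridGraph_step hN hW] at hu
    rcases hu with hu | hu <;> rwa [hu.2]

theorem gridGraph_initRegs (v : ZMod N × Fin h) : (gridGraph M N h inp).InitRegs v := by
  refine ⟨fun hD r => ?_, fun hD r => ?_⟩
  · rw [gridGraph_has_D hN hW] at hD
    refine gridGraph_sameEdge_right hN hW inp (Nat.zero_le _) ?_
    rw [Nat.eq_zero_of_not_pos hD]
    rfl
  · obtain ⟨u, hu⟩ := (gridGraph_has hN hW ..).1 hD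
    refine ⟨(v.1 + (M.linkLen v.2 r 0 : ZMod N), v.2), ?_, ?_⟩
    · exact gridGraph_leadsTo_cons hN hW inp ((gridRel_lk (Nat.zero_le _) ..).2 rfl)
        (gridGraph_leadsTo_nil inp _)
    · refine gridGraph_leadsTo_cons hN hW inp hu (gridGraph_leadsTo_cons hN hW inp
        ((gridRel_lk le_rfl ..).2 rfl) (gridGraph_leadsTo_cons hN hW inp
          (w := (v.1 + (M.linkLen v.2 r 0 : ZMod N), v.2)) ⟨?_, hu.2.symm⟩
          (gridGraph_leadsTo_nil inp _)))
      dsimp only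
      rw [hu.1, M.linkLen_p, hu.2]

/-- The link edges of each row record a run of the program. -/
theorem gridGraph_execOK (v : ZMod N × Fin h) (l : List (Instr M.k)) : ∀ i d : ℕ,
    M.prog.drop i = l → (M.midState v.2 i).2 = d → (gridGraph M N h inp).ExecOK v l i d := by
  induction l with
  | nil => intro i d _ _; simp only [EncGraph.ExecOK]
  | cons ins l ih =>
    intro i d hl hd
    have hi : i < M.prog.length := by
      by_contra hcon
      rw [List.drop_eq_nil_of_le (not_lt.1 hcon)] at hl
      exact List.cons_ne_nil _ _ hl.symm
    rw [List.drop_eq_getElem_cons hi, List.cons.injEq] at hl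
    have hi' : i ≤ M.p := hi.le
    have hi1 : i + 1 ≤ M.p := hi
    have hstep := M.midState_succ v.2 hi
    rw [hl.1] at hstep
    have hnext := ih (i + 1) (M.midState v.2 (i + 1)).2 hl.2 rfl
    have hkeep : ∀ r, M.linkLen v.2 r i = M.linkLen v.2 r (i + 1) →
        (gridGraph M N h inp).Keep v i r := fun r hr =>
      (gridGraph_sameEdge_lk hN hW inp hi' hi1 r r v).2 hr
    simp only [LinkMachine.linkLen] at hkeep
    have hcond : ∀ a b, (gridGraph M N h inp).SameEdge (M.lk a i) (M.lk b i) v ↔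
        (M.midState v.2 i).1 a = (M.midState v.2 i).1 b := fun a b =>
      gridGraph_sameEdge_lk hN hW inp hi' hi' a b v
    have hval : ∀ r, M.linkLen v.2 r (i + 1) = (M.midState v.2 (i + 1)).1 r := fun _ => rfl
    have hval' : ∀ r, M.linkLen v.2 r i = (M.midState v.2 i).1 r := fun _ => rfl
    generalize M.midState v.2 i = q at *
    obtain ⟨f, e⟩ := q
    obtain rfl : e = d := hd
    rw [hstep] at hnext hkeep hval
    cases e with
    | succ e => cases ins <;> exact ⟨fun r => hkeep r rfl, hnext⟩
    | zero =>
      cases ins with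
      | add a b c =>
        refine ⟨?_, fun r hr => hkeep r (by simp [Instr.step, hr]), hnext⟩
        refine ⟨(v.1 + (M.linkLen v.2 a (i + 1) : ZMod N), v.2), ?_, ?_⟩
        · exact gridGraph_leadsTo_cons hN hW inp ((gridRel_lk hi1 ..).2 rfl)
            (gridGraph_leadsTo_nil inp _)
        · refine gridGraph_leadsTo_cons hN hW inp ((gridRel_lk hi' ..).2 rfl)
            (gridGraph_leadsTo_cons hN hW inp ((gridRel_lk hi' ..).2 ?_)
              (gridGraph_leadsTo_nil inp _))
          simp [hval, hval', Instr.step, add_assoc]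
      | reset a =>
        exact ⟨gridGraph_sameEdge_right hN hW inp hi1 (by simp [hval, Instr.step]),
          fun r hr => hkeep r (by simp [Instr.step, hr]), hnext⟩
      | ifEq a b s =>
        refine ⟨fun r => hkeep r rfl, fun hs => ?_, fun hs => ?_⟩
        · rw [hcond] at hs
          simpa [Instr.step, show f a = f b from hs] using hnext
        · rw [hcond] at hs
          simpa [Instr.step, show ¬ f a = f b from hs] using hnext
      | ifNe a b s =>
        refine ⟨fun r => hkeep r rfl, fun hs => ?_, fun hs => ?_⟩
        · rw [hcond] at hs
          simpa [Instr.step, show ¬ f a = f b from hs] using hnext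
        · rw [hcond] at hs
          simpa [Instr.step, show f a = f b from hs] using hnext

theorem gridGraph_localOK (m : Fin M.k) {v : ZMod N × Fin h} (hv : (v.2 : ℕ) + 1 < h) :
    (gridGraph M N h inp).LocalOK m v :=
  ⟨gridGraph_basic hN hW inp (by omega) v, gridGraph_grid hN hW inp v,
    gridGraph_initRegs hN hW inp v, gridGraph_execOK hN hW inp v _ 0 0 rfl rfl,
    fun hU => absurd ((gridGraph_has_U hN hW inp v).2 hv) hU⟩

omit hW hN in
theorem GridRel.row_le {x : EdgeLabel M} {v u : ZMod N × Fin h} (hx : GridRel M N h x v u) :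
    (u.2 : ℕ) ≤ v.2 + 1 ∧ (v.2 : ℕ) ≤ u.2 + 1 := by
  rcases x with (_ | _ | _ | _) | ⟨r, i⟩ <;> have := hx.2 <;> omega

theorem gridGraph_adj_row_le {v u : ZMod N × Fin h} (huv : (gridGraph M N h inp).graph.Adj v u) :
    (u.2 : ℕ) ≤ v.2 + 1 := by
  obtain ⟨x, hx | hx⟩ := (gridGraph_adj hN hW inp v u).1 huv
  · exact hx.row_le.1
  · exact hx.row_le.2

/-- Whatever happens in the top row, it is noticed only in the two topmost rows. -/
theorem gridGraph_not_nearError (m : Fin M.k) {v : ZMod N × Fin h} (hv : (v.2 : ℕ) + 2 < h) :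
    ¬ (gridGraph M N h inp).NearError m v := by
  rintro (hcon | ⟨u, hu, hcon⟩)
  · exact hcon (gridGraph_localOK hN hW inp m (by omega))
  · have := gridGraph_adj_row_le hN hW inp hu
    exact hcon (gridGraph_localOK hN hW inp m (by omega))

end LocalConstraints

/-! ### What the bottom row sees -/

/-- Identifiers of the grid, obtained from those of the cycle. -/
def gridIdent {N : ℕ} (h : ℕ) (w : ZMod N → ℕ × Bool) (v : ZMod N × Fin h) : ℕ :=
  (w v.1).1 * h + v.2

/-- Inputs of the grid: the cycle inputs in row `0`, and the bit `b` in the rows above row `t`. -/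
def gridInput {N : ℕ} (h t : ℕ) (w : ZMod N → ℕ × Bool) (b : Bool) (v : ZMod N × Fin h) : Bool :=
  if (v.2 : ℕ) = 0 then (w v.1).2 else decide (t < (v.2 : ℕ)) && b

theorem gridIdent_injective {N h c : ℕ} {w : ZMod N → ℕ × Bool} (hw : LegalIds c w) :
    Function.Injective (gridIdent h w) := by
  rintro ⟨a, i⟩ ⟨b, j⟩ hab
  simp only [gridIdent] at hab
  have hi := i.2
  have hj := j.2
  have hdiv : (w a).1 = (w b).1 := by
    have := congrArg (· / h) hab
    simpa [mul_comm _ h, Nat.mul_add_div (show 0 < h by omega), Nat.div_eq_of_lt hi,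
      Nat.div_eq_of_lt hj] using this
  have : (i : ℕ) = j := by rw [hdiv] at hab; omega
  exact Prod.ext (hw.1 hdiv) (Fin.ext this)

theorem gridIdent_lt {N h c : ℕ} (hc : 1 ≤ c) {w : ZMod N → ℕ × Bool} (hw : LegalIds c w)
    (v : ZMod N × Fin h) : gridIdent h w v < (N * h) ^ c := by
  have h1 := hw.2 v.1
  have h2 := v.2.2
  calc gridIdent h w v < ((w v.1).1 + 1) * h := by rw [gridIdent, add_mul]; omega
    _ ≤ N ^ c * h := Nat.mul_le_mul_right _ h1
    _ ≤ N ^ c * h ^ c := Nat.mul_le_mul_left _ (Nat.le_self_pow (by omega) h)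
    _ = (N * h) ^ c := (mul_pow ..).symm

theorem gridRel_rotate {M : LinkMachine} {N h : ℕ} (s : ZMod N) (x : EdgeLabel M)
    (a b : ZMod N × Fin h) :
    GridRel M N h x (a.1 + s, a.2) (b.1 + s, b.2) ↔ GridRel M N h x a b := by
  rcases x with (_ | _ | _ | _) | ⟨r, i⟩ <;>
    simp only [GridRel, add_left_inj, add_right_comm _ s, sub_eq_add_neg]

/-- Rotation of the grid. -/
def gridRotation {M : LinkMachine} {N h : ℕ} (inp inp' : ZMod N × Fin h → Bool) (s : ZMod N) :
    (gridGraph M N h inp).graph ≃g (gridGraph M N h inp').graph where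
  toEquiv := (Equiv.addRight s).prodCongr (Equiv.refl _)
  map_rel_iff' {a b} := by
    have hne : ((a.1 + s, a.2) ≠ (b.1 + s, b.2)) ↔ a ≠ b := by
      simp [Prod.ext_iff]
    change (gridGraph M N h inp').graph.Adj (a.1 + s, a.2) (b.1 + s, b.2) ↔ _
    simp only [gridGraph, SimpleGraph.fromRel_adj, gridRel_rotate, hne]

section View

variable {M : LinkMachine} {N h W : ℕ} (hN : 3 ≤ N) (hWN : W < N)
  (hW : ∀ y < h, ∀ r i, M.linkLen y r i ≤ W)

include hN hWN hW

/-- In `t` steps one moves at most `t` rows up, and at most `t * W` columns sideways. -/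
theorem gridGraph_walk_displacement (hW1 : 1 ≤ W) (inp : ZMod N × Fin h → Bool)
    {v u : ZMod N × Fin h} (q : (gridGraph M N h inp).graph.Walk v u) :
    (u.2 : ℕ) ≤ v.2 + q.length ∧ ∃ d : ℤ, |d| ≤ q.length * W ∧ u.1 = v.1 + d := by
  have hW' : ∀ y < h, ∀ r i, M.linkLen y r i < N := fun y hy r i => (hW y hy r i).trans_lt hWN
  induction q with
  | nil => exact ⟨by simp, 0, by simp⟩
  | @cons a b e hab q ih =>
    obtain ⟨hrow, d, hd, hcol⟩ := ih
    have h1 := gridGraph_adj_row_le hN hW' inp hab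
    refine ⟨by rw [SimpleGraph.Walk.length_cons]; omega, ?_⟩
    have hrel : ∀ (x : EdgeLabel M) (a b : ZMod N × Fin h), GridRel M N h x a b →
        ∃ d : ℤ, |d| ≤ W ∧ b.1 = a.1 + d := by
      intro x a b hx
      have h1' : (1 : ℤ) ≤ W := by exact_mod_cast hW1
      rcases x with (_ | _ | _ | _) | ⟨r, i⟩
      · exact ⟨0, by simp, by simpa using hx.1⟩
      · exact ⟨0, by simp, by simpa using hx.1⟩
      · exact ⟨-1, by simpa using h1', by simpa [← sub_eq_add_neg] using hx.1⟩
      · exact ⟨1, by simpa using h1', by simpa using hx.1⟩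
      · exact ⟨M.linkLen a.2 r i, by simpa using hW a.2 a.2.2 r i, by simpa using hx.1⟩
    have hab' : ∃ d : ℤ, |d| ≤ W ∧ b.1 = a.1 + d := by
      obtain ⟨x, hx | hx⟩ := (gridGraph_adj hN hW' inp a b).1 hab
      · exact hrel x a b hx
      · obtain ⟨d, hd, he⟩ := hrel x b a hx
        exact ⟨-d, by rwa [abs_neg], by rw [he]; push_cast; ring⟩
    obtain ⟨d', hd', he⟩ := hab'
    refine ⟨d' + d, ?_, by rw [hcol, he]; push_cast; ring⟩
    rw [SimpleGraph.Walk.length_cons]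
    calc |d' + d| ≤ |d'| + |d| := abs_add_le _ _
      _ ≤ W + q.length * W := add_le_add hd' hd
      _ = _ := by push_cast; ring

/-- The neighbourhood of a node of row `0` depends only on a window of the cycle, and not on the
input bits that are far up. -/
theorem gridGraph_view_eq (hW1 : 1 ≤ W) (h0 : 0 < h) {t R : ℕ} (hR : t * W ≤ R)
    {w w' : ZMod N → ℕ × Bool} {x x' : ZMod N} (hw : WindowEq R w w' x x') (b b' : Bool) :
    (gridGraph M N h (gridInput h t w' b')).view (gridIdent h w') t (x', ⟨0, h0⟩) =
      (gridGraph M N h (gridInput h t w b)).view (gridIdent h w) t (x, ⟨0, h0⟩) := by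
  have hW' : ∀ y < h, ∀ r i, M.linkLen y r i < N := fun y hy r i => (hW y hy r i).trans_lt hWN
  have := LabGraph.view_eq_of_iso (gridGraph M N h (gridInput h t w b))
    (gridGraph M N h (gridInput h t w' b')) (gridIdent h w) (gridIdent h w') t (x, ⟨0, h0⟩)
    (gridRotation _ _ (x' - x)) ?_ ?_
  · rw [← this]
    congr 1
    exact Prod.ext (by simp [gridRotation]) rfl
  · intro u v _ _
    ext y
    exact gridRel_rotate (x' - x) y u v
  · intro u hu
    obtain ⟨q, hq⟩ := (gridGraph_connected hN hW' (gridInput h t w b)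
      h0).exists_walk_length_eq_dist (x, ⟨0, h0⟩) u
    obtain ⟨hrow, d, hd, hcol⟩ := gridGraph_walk_displacement hN hWN hW hW1 _ q
    rw [← hq] at hu
    have hrow' : (u.2 : ℕ) ≤ t := by simpa using hrow.trans (by simpa using hu)
    have hdR : |d| ≤ R := by
      refine hd.trans ?_
      exact_mod_cast (Nat.mul_le_mul_right W hu).trans hR
    have e : (gridRotation (M := M) (gridInput h t w b) (gridInput h t w' b') (x' - x)) u =
        (x' + d, u.2) := by
      refine Prod.ext ?_ rfl
      change u.1 + (x' - x) = x' + d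
      rw [hcol]; ring
    have hwd := hw d hdR
    rw [e]
    obtain ⟨a, y⟩ := u
    obtain rfl : a = x + d := hcol
    refine ⟨by simp only [gridIdent, hwd], ?_⟩
    change gridInput h t w' b' _ = gridInput h t w b _
    simp only [gridInput, hwd, not_lt.2 hrow', decide_false, Bool.false_and]

end View

/-! ### Correct outputs in the bottom row -/

section Bottom

variable {Γ : Type} {P : CycleLCL Γ} {M : LinkMachine} {m : Fin M.k} {N h : ℕ} (hN : 3 ≤ N)
  (hW : ∀ y < h, ∀ r i, M.linkLen y r i < N)

include hN hW

/-- An upward error pointer starts a chain of such pointers, which ends in one of the two topmost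
rows and therefore carries the input bit that is found there. -/
theorem ptrU_label_eq {t : ℕ} (ht : t + 2 < h) {w : ZMod N → ℕ × Bool} {b : Bool}
    {out : ZMod N × Fin h → OutLabel Γ}
    (hok : ∀ v, (gridGraph M N h (gridInput h t w b)).OutputOK m P out v) :
    ∀ (n : ℕ) (v : ZMod N × Fin h) (ctr ce : Bool), (v.2 : ℕ) + n = h →
      out v = .ptrU ctr ce → ce = b := by
  intro n
  induction n with
  | zero => intro v _ _ hv; exact absurd v.2.2 (by omega)
  | succ n ih =>
    intro v ctr ce hv hout
    obtain ⟨u, hu, hcase⟩ := (hok v).2.2.2.2.2 ctr ce hout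
    rw [gridGraph_step hN hW] at hu
    have hrow := hu.2
    rcases hcase with ⟨herr, hce⟩ | ⟨ctr', hptr | hptr⟩
    · have hnear := (hok u).1.2 herr
      have htop : h ≤ (u.2 : ℕ) + 2 :=
        not_lt.1 fun hlt => gridGraph_not_nearError hN hW _ m hlt hnear
      rw [hce]
      change gridInput h t w b u = b
      rw [gridInput, if_neg (by omega), decide_eq_true (by omega), Bool.true_and]
    · have := ((hok u).2.2.2.2.1 _ _ hptr).1
      rw [gridGraph_has_D hN hW] at this
      omega
    · exact ih u ctr' ce (by omega) hptr

/-- In the bottom row every node solves the cycle problem or points to the right: errors are too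
far away, and an upward pointer would have to know an input bit from outside its
neighbourhood. -/
theorem bottom_sol_or_ptrR {t : ℕ} (ht : t + 2 < h) {w : ZMod N → ℕ × Bool}
    {out : Bool → ZMod N × Fin h → OutLabel Γ} (h0 : 0 < h)
    (hok : ∀ b v, (gridGraph M N h (gridInput h t w b)).OutputOK m P (out b) v)
    (heq : ∀ x, out true (x, ⟨0, h0⟩) = out false (x, ⟨0, h0⟩)) (x : ZMod N) :
    (∃ y, out false (x, ⟨0, h0⟩) = .sol y) ∨
      ∃ ctr ce, out false (x, ⟨0, h0⟩) = .ptrR ctr ce := by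
  have hD : ¬ (gridGraph M N h (gridInput h t w false)).Has (.dir .D) (x, ⟨0, h0⟩) := by
    rw [gridGraph_has_D hN hW]
    exact lt_irrefl 0
  rcases hcase : out false (x, ⟨0, h0⟩) with y | _ | ⟨ctr, ce⟩ | ⟨ctr, ce⟩ | _
  · exact Or.inl ⟨y, rfl⟩
  · exact absurd ((hok false _).1.2 hcase)
      (gridGraph_not_nearError hN hW _ m (show 0 + 2 < h by omega))
  · exact Or.inr ⟨ctr, ce, rfl⟩
  · have h1 := ptrU_label_eq hN hW ht (hok false) h (x, ⟨0, h0⟩) ctr ce (Nat.zero_add _) hcase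
    have h2 := ptrU_label_eq hN hW ht (hok true) h (x, ⟨0, h0⟩) ctr ce (Nat.zero_add _)
      ((heq x).trans hcase)
    exact absurd (h1.symm.trans h2) (by simp)
  · exact absurd ((hok false _).2.2.2.1 hcase) hD

/-- A right pointer in the bottom row spreads along the whole row, with alternating counters. -/
theorem bottom_ptrR_succ {inp : ZMod N × Fin h → Bool} {out : ZMod N × Fin h → OutLabel Γ}
    (h0 : 0 < h) (hok : ∀ v, (gridGraph M N h inp).OutputOK m P out v)
    (hsol : ∀ x, (∃ y, out (x, ⟨0, h0⟩) = .sol y) ∨ ∃ ctr ce, out (x, ⟨0, h0⟩) = .ptrR ctr ce)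
    {x : ZMod N} {ctr ce : Bool} (hx : out (x, ⟨0, h0⟩) = .ptrR ctr ce) :
    ∃ ce', out (x + 1, ⟨0, h0⟩) = .ptrR (!ctr) ce' := by
  obtain ⟨-, ⟨u, hu, hcase⟩, hctr⟩ := (hok _).2.2.2.2.1 ctr ce hx
  rw [gridGraph_step hN hW] at hu
  obtain rfl : u = (x + 1, ⟨0, h0⟩) := Prod.ext hu.1 hu.2
  rcases hsol (x + 1) with ⟨y, hy⟩ | ⟨ctr', ce', hy⟩
  · rw [hy] at hcase
    rcases hcase with hcase | ⟨_, _, hcase | hcase⟩ <;> exact absurd hcase (by simp)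
  · have := hctr _ ((gridGraph_step hN hW inp _ _ _).2 hu) ctr' ce' hy
    refine ⟨ce', ?_⟩
    rw [hy]
    cases ctr <;> cases ctr' <;> simp_all

end Bottom

/-! ### Alternating labels cannot be found locally -/

/-- Moves one column of a cycle, from position `R + 1` to position `3 * R + 3`. -/
def moveColumn (R z : ℕ) : ℕ :=
  if z = R + 1 then 3 * R + 3 else if R + 1 < z ∧ z ≤ 3 * R + 3 then z - 1 else z

theorem moveColumn_injective (R : ℕ) : Function.Injective (moveColumn R) := by
  intro a b hab
  simp only [moveColumn] at hab
  split_ifs at hab <;> omega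

theorem moveColumn_lt {R N z : ℕ} (hN : 4 * R + 4 ≤ N) (hz : z < N) : moveColumn R z < N := by
  simp only [moveColumn]
  split_ifs <;> omega

/-- Moving one node from between two windows to the outside changes the parity of their
distance, which no node can notice locally. -/
theorem eq_none_of_local_of_alternating {c N R : ℕ} (hN : 4 * R + 4 ≤ N)
    (col : (ZMod N → ℕ × Bool) → ZMod N → Option Bool)
    (hloc : ∀ w w' x x', LegalIds c w → LegalIds c w' → WindowEq R w w' x x' →
      col w x = col w' x')
    (halt : ∀ w, LegalIds c w → ∀ x b, col w x = some b → col w (x + 1) = some !b)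
    {w : ZMod N → ℕ × Bool} (hw : LegalIds c w) (x : ZMod N) : col w x = none := by
  have : NeZero N := ⟨by omega⟩
  by_contra hne
  obtain ⟨b, hb⟩ := Option.ne_none_iff_exists'.1 hne
  have hiter : ∀ w, LegalIds c w → col w x = some b → ∀ n : ℕ,
      col w (x + n) = some (not^[n] b) := by
    intro w hw hb n
    induction n with
    | zero => simpa using hb
    | succ n ih =>
      rw [Function.iterate_succ_apply', Nat.cast_succ, ← add_assoc]
      exact halt w hw _ _ ih
  set w' : ZMod N → ℕ × Bool := fun a => w (x + (moveColumn R (a - x).val : ℕ)) with hw'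
  have hlegal : LegalIds c w' := by
    refine ⟨fun a a' haa => ?_, fun a => hw.2 _⟩
    have h1 := add_left_cancel (hw.1 haa)
    rw [ZMod.natCast_eq_natCast_iff', Nat.mod_eq_of_lt (moveColumn_lt hN (ZMod.val_lt _)),
      Nat.mod_eq_of_lt (moveColumn_lt hN (ZMod.val_lt _))] at h1
    exact sub_left_injective (ZMod.val_injective N (moveColumn_injective R h1))
  have hval : ∀ (n : ℕ), n < N → w' (x + n) = w (x + (moveColumn R n : ℕ)) := by
    intro n hn
    simp only [hw', add_sub_cancel_left, ZMod.val_natCast_of_lt hn]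
  have h1 : WindowEq R w w' x x := by
    intro d hd
    rw [abs_le] at hd
    obtain ⟨n, hn, hfix, hcast⟩ : ∃ n : ℕ, n < N ∧ moveColumn R n = n ∧ (d : ZMod N) = n := by
      rcases le_or_gt 0 d with h0 | h0
      · lift d to ℕ using h0
        exact ⟨d, by omega, by rw [moveColumn, if_neg (by omega), if_neg (by omega)], by simp⟩
      · refine ⟨(d + N).toNat, by omega, ?_, ?_⟩
        · rw [moveColumn, if_neg (by omega), if_neg (by omega)]
        · have : (((d + N).toNat : ℤ) : ZMod N) = ((d + N : ℤ) : ZMod N) := by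
            rw [Int.toNat_of_nonneg (by omega)]
          rw [Int.cast_natCast] at this
          rw [this]
          simp
    rw [hcast, hval n hn, hfix]
  have h2 : WindowEq R w w' (x + (2 * R + 2 : ℕ)) (x + (2 * R + 3 : ℕ)) := by
    intro d hd
    rw [abs_le] at hd
    obtain ⟨n, hn⟩ : ∃ n : ℕ, (n : ℤ) = 2 * R + 2 + d := ⟨(2 * R + 2 + d).toNat, by omega⟩
    have e1 : (x + (2 * R + 2 : ℕ) + d : ZMod N) = x + (n : ℕ) := by
      have := congrArg (Int.cast (R := ZMod N)) hn
      push_cast at this ⊢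
      rw [this]; ring
    have e2 : (x + (2 * R + 3 : ℕ) + d : ZMod N) = x + (n + 1 : ℕ) := by
      have := congrArg (Int.cast (R := ZMod N)) hn
      push_cast at this ⊢
      rw [this]; ring
    rw [e1, e2, hval (n + 1) (by omega), moveColumn, if_neg (by omega), if_pos (by omega),
      Nat.add_sub_cancel]
  have hb' : col w' x = some b := by rw [← hloc w w' x x hw hlegal h1, hb]
  have h3 := hloc w w' _ _ hw hlegal h2
  rw [hiter w hw hb, hiter w' hlegal hb', Function.iterate_succ_apply' not (2 * R + 2) b] at h3
  simp at h3

/-! ### The induced algorithm on cycles -/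

/-- A fast algorithm for the link machine problem, run in the bottom row of a grid, solves the
cycle problem on cycles of length `N`, looking at windows of radius `t * W`. -/
theorem exists_rule_of_solves_grid {Γ : Type} {P : CycleLCL Γ} {M : LinkMachine} {m : Fin M.k}
    {Δ c N h t W : ℕ} (hΔ : 2 * M.k * (M.p + 1) + 4 ≤ Δ) (hc : 1 ≤ c) (hN : 3 ≤ N)
    (hW1 : 1 ≤ W) (hWN : W < N) (hW : ∀ y < h, ∀ r i, M.linkLen y r i ≤ W) (ht : t + 2 < h)
    (hR : 4 * (t * W) + 4 ≤ N) (y0 : Γ) (A : View Bool (Set (EdgeLabel M)) → OutLabel Γ)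
    (hA : ∀ I : EncGraph M (ZMod N × Fin h), (linkProblem M m P Δ).IsInstance I →
      ∀ ident : ZMod N × Fin h → ℕ, Function.Injective ident → (∀ v, ident v < (N * h) ^ c) →
        (linkProblem M m P Δ).Valid I fun v => A (I.view ident t v)) :
    ∃ F : (ZMod N → ℕ × Bool) → ZMod N → Γ,
      (∀ w w' x x', LegalIds c w → LegalIds c w' → WindowEq (t * W) w w' x x' →
        F w x = F w' x') ∧
      ∀ w, LegalIds c w → ∀ v, P.ConstraintsAt (fun a b => b = a + 1) (fun a => (w a).2)
        (fun a y => F w a = y) v := by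
  have h0 : 0 < h := by omega
  have hW' : ∀ y < h, ∀ r i, M.linkLen y r i < N := fun y hy r i => (hW y hy r i).trans_lt hWN
  set out : (ZMod N → ℕ × Bool) → Bool → ZMod N × Fin h → OutLabel Γ := fun w b v =>
    A ((gridGraph M N h (gridInput h t w b)).view (gridIdent h w) t v) with hout
  have hok : ∀ w, LegalIds c w → ∀ b v,
      (gridGraph M N h (gridInput h t w b)).OutputOK m P (out w b) v := fun w hw b =>
    hA _ ⟨gridGraph_connected hN hW' _ h0, fun v => (gridGraph_degree hN hW' _ v).trans hΔ⟩
      _ (gridIdent_injective hw) (gridIdent_lt hc hw)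
  have hloc : ∀ w w' x x' b b', WindowEq (t * W) w w' x x' →
      out w b (x, ⟨0, h0⟩) = out w' b' (x', ⟨0, h0⟩) := fun w w' x x' b b' hw => by
    simp only [hout, gridGraph_view_eq hN hWN hW hW1 h0 le_rfl hw b b']
  have hbottom := fun w (hw : LegalIds c w) => bottom_sol_or_ptrR hN hW' ht h0 (hok w hw)
    fun x => hloc w w x x true false fun _ _ => rfl
  let col : (ZMod N → ℕ × Bool) → ZMod N → Option Bool := fun w x =>
    match out w false (x, ⟨0, h0⟩) with
    | .ptrR ctr _ => some ctr
    | _ => none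
  have hcol : ∀ w, LegalIds c w → ∀ x, col w x = none := by
    intro w hw x
    refine eq_none_of_local_of_alternating hR col (fun w w' x x' _ _ hww => ?_)
      (fun w hw x b hb => ?_) hw x
    · simp only [col, hloc w w' x x' false false hww]
    · rcases hbottom w hw x with ⟨y, hy⟩ | ⟨ctr, ce, hy⟩
      · simp [col, hy] at hb
      · obtain ⟨ce', hy'⟩ := bottom_ptrR_succ hN hW' h0 (hok w hw false) (hbottom w hw) hy
        simp only [col, hy, Option.some.injEq] at hb
        simp only [col, hy', hb]
  have hsol : ∀ w, LegalIds c w → ∀ x, ∃ y, out w false (x, ⟨0, h0⟩) = .sol y := by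
    intro w hw x
    rcases hbottom w hw x with hy | ⟨ctr, ce, hy⟩
    · exact hy
    · have := hcol w hw x
      simp [col, hy] at this
  let F : (ZMod N → ℕ × Bool) → ZMod N → Γ := fun w x =>
    match out w false (x, ⟨0, h0⟩) with
    | .sol y => y
    | _ => y0
  refine ⟨F, fun w w' x x' _ _ hww => ?_, fun w hw v j hj u y hu hnext hy => ?_⟩
  · simp only [F, hloc w w' x x' false false hww]
  · have hsolF : ∀ x, out w false (x, ⟨0, h0⟩) = .sol (F w x) := by
      intro x
      obtain ⟨y, hy⟩ := hsol w hw x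
      simp only [F, hy]
    have := (hok w hw false (v, ⟨0, h0⟩)).2.2.1 j hj (fun i => (u i, ⟨0, h0⟩)) y
      (by rw [hu]) (fun i => (gridGraph_step hN hW' _ _ _ _).2 ⟨hnext i, rfl⟩)
      (fun i => by rw [← hy i]; exact hsolF _)
    simpa [gridGraph, gridInput] using this

/-! ### Errors next to a node cannot be noticed without communication -/

/-- An algorithm for the link machine problem communicates on `N × 3` grids: erasing the labels
at a neighbour of a bottom node forces an error output there. -/
theorem pos_of_solves_grid {Γ : Type} {P : CycleLCL Γ} {M : LinkMachine} {m : Fin M.k}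
    {Δ c N t : ℕ} (hΔ : 2 * M.k * (M.p + 1) + 4 ≤ Δ) (hc : 1 ≤ c) (hN : 3 ≤ N)
    (hW : ∀ y < 3, ∀ r i, M.linkLen y r i < N) (A : View Bool (Set (EdgeLabel M)) → OutLabel Γ)
    (hA : ∀ I : EncGraph M (ZMod N × Fin 3), (linkProblem M m P Δ).IsInstance I →
      ∀ ident : ZMod N × Fin 3 → ℕ, Function.Injective ident → (∀ v, ident v < (N * 3) ^ c) →
        (linkProblem M m P Δ).Valid I fun v => A (I.view ident t v)) : 0 < t := by
  classical
  have : NeZero N := ⟨by omega⟩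
  by_contra ht
  obtain rfl : t = 0 := by omega
  let w : ZMod N → ℕ × Bool := fun a => (a.val, false)
  have hw : LegalIds c w := ⟨ZMod.val_injective N, fun a =>
    (ZMod.val_lt a).trans_le (Nat.le_self_pow (by omega) N)⟩
  let I : EncGraph M (ZMod N × Fin 3) := gridGraph M N 3 fun _ => false
  let J : EncGraph M (ZMod N × Fin 3) :=
    { I with half := fun u v => if u = (1, 0) then ∅ else I.half u v }
  have hinst : (linkProblem M m P Δ).IsInstance I :=
    ⟨gridGraph_connected hN hW _ three_pos, fun v => (gridGraph_degree hN hW _ v).trans hΔ⟩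
  have hne : ((0, 0) : ZMod N × Fin 3) ≠ (1, 0) := fun h =>
    ZMod.one_ne_zero_of_three_le hN (congrArg Prod.fst h).symm
  have hview : J.view (gridIdent 3 w) 0 (0, 0) = I.view (gridIdent 3 w) 0 (0, 0) := by
    refine LabGraph.view_eq_of_iso I J _ _ 0 (0, 0) (SimpleGraph.Iso.refl) (fun u v hu _ => ?_)
      fun _ _ => ⟨rfl, rfl⟩
    obtain rfl : (0, 0) = u := hinst.1.dist_eq_zero_iff.1 (Nat.le_zero.1 hu)
    exact if_neg hne
  have hI := (hA I hinst _ (gridIdent_injective hw) (gridIdent_lt hc hw) (0, 0)).1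
  have hJ := (hA J hinst _ (gridIdent_injective hw) (gridIdent_lt hc hw) (0, 0)).1
  beta_reduce at hI hJ
  rw [hview] at hJ
  refine gridGraph_not_nearError hN hW (fun _ => false) m (v := (0, 0)) (by simp)
    (hI.2 (hJ.1 (Or.inr ⟨(1, 0), ?_, ?_⟩)))
  · exact (gridGraph_adj hN hW (fun _ => false) _ _).2 ⟨.dir .R, Or.inl ⟨by simp, rfl⟩⟩
  · -- the node `(1, 0)` has no edge labelled `R` any more
    intro hok
    obtain ⟨u, hu, -⟩ := hok.1.2.2.1
    have := hu.2
    simp [J] at this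

/-! ### Growth rates -/

theorem exists_natBound_of_isBigO {f g : ℕ → ℕ}
    (h : (fun n => (f n : ℝ)) =O[atTop] fun n => (g n : ℝ)) :
    ∃ C N₀ : ℕ, ∀ n ≥ N₀, f n ≤ C * g n := by
  obtain ⟨C, hC⟩ := h.bound
  obtain ⟨N₀, hN₀⟩ := eventually_atTop.1 hC
  refine ⟨⌈C⌉₊, N₀, fun n hn => ?_⟩
  have := hN₀ n hn
  rw [Real.norm_natCast, Real.norm_natCast] at this
  have h2 : (f n : ℝ) ≤ ⌈C⌉₊ * g n :=
    this.trans (mul_le_mul_of_nonneg_right (Nat.le_ceil C) (Nat.cast_nonneg _))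
  exact_mod_cast h2

theorem exists_mul_le_of_isLittleO {f g : ℕ → ℕ}
    (h : (fun n => (f n : ℝ)) =o[atTop] fun n => (g n : ℝ)) (K : ℕ) :
    ∃ N₀ : ℕ, ∀ n ≥ N₀, K * f n ≤ g n := by
  obtain ⟨N₀, hN₀⟩ := eventually_atTop.1 (h.def (c := 1 / (K + 1)) (by positivity))
  refine ⟨N₀, fun n hn => ?_⟩
  have := hN₀ n hn
  rw [Real.norm_natCast, Real.norm_natCast, one_div, inv_mul_eq_div,
    le_div_iff₀ (by positivity)] at this
  have h2 : f n * (K + 1) ≤ g n := by exact_mod_cast this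
  nlinarith

theorem lt_of_lt_genInv {f : ℕ → ℕ} {x j : ℕ} (h : j < genInv f x) : f j < x :=
  not_le.1 (Nat.notMem_of_lt_sInf (s := {m | x ≤ f m}) h)

theorem le_nHat_mul_genInv {f T : ℕ → ℕ} {n : ℕ} (h : nHat f T n ≠ 0) :
    n ≤ nHat f T n * genInv f (T (nHat f T n)) := by
  refine Nat.sInf_mem (s := {m | n ≤ m * genInv f (T m)}) (Set.nonempty_iff_ne_empty.2 fun he => ?_)
  exact h (by rw [nHat, he, Nat.sInf_empty])

/-- The grid whose width is `nHat f T n` and whose height belongs to that width may have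
more than `n` nodes, but has the same value of `nHat`. -/
theorem nHat_mul_genInv {f T : ℕ → ℕ} {n : ℕ} (h : nHat f T n ≠ 0) :
    nHat f T (nHat f T n * genInv f (T (nHat f T n))) = nHat f T n := by
  have hn := le_nHat_mul_genInv h
  refine le_antisymm (Nat.sInf_le (Set.mem_ofPred_eq.mpr le_rfl)) ?_
  refine le_csInf ⟨nHat f T n, Set.mem_ofPred_eq.mpr le_rfl⟩ fun j hj => ?_
  exact Nat.sInf_le (hn.trans hj)

/-! ### The lower bound -/

/-- By minimality of the height `l = genInv M.speedup x`, the horizontal distance that can be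
covered in `l` rounds in a grid of that height is at most a constant times `x`. -/
theorem genInv_speedup_mul_lt {M : LinkMachine} {x : ℕ} (hx : 2 ≤ genInv M.speedup x) :
    genInv M.speedup x * (2 ^ M.p * M.growth (genInv M.speedup x - 1)) < 2 ^ (M.p + 1) * x := by
  have hlt : (genInv M.speedup x - 1) * M.growth (genInv M.speedup x - 1) < x :=
    lt_of_lt_genInv (f := M.speedup) (by omega)
  set l := genInv M.speedup x
  set g := M.growth (l - 1)
  calc l * (2 ^ M.p * g) ≤ (2 * (l - 1)) * (2 ^ M.p * g) := Nat.mul_le_mul_right _ (by omega)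
    _ = 2 ^ (M.p + 1) * ((l - 1) * g) := by ring
    _ < 2 ^ (M.p + 1) * x := Nat.mul_lt_mul_of_pos_left hlt (by positivity)

theorem mainTheorem5 {Γ : Type} [Finite Γ] (P : CycleLCL Γ) (M : LinkMachine) (m : Fin M.k)
    (hmono : Monotone M.growth) (htop : Tendsto M.growth atTop atTop)
    (hmax : ∀ l r, M.regs l r ≤ M.regs l m)
    (Δ : ℕ) (hΔ : 2 * M.k * (M.p + 1) + 4 ≤ Δ) (c : ℕ) (hc : 1 ≤ c)
    (T : ℕ → ℕ) (hT : P.problem.IsTimeComplexity c T) :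
    ¬ ∃ t : ℕ → ℕ, (linkProblem M m P Δ).SolvableInTime c t ∧
      (fun n => (t n : ℝ)) =o[atTop]
        (fun n => (genInv M.speedup (T (nHat M.speedup T n)) : ℝ)) := by
  classical
  rintro ⟨t, ⟨A, hA⟩, hto⟩
  have hgrid : ∀ N h : ℕ, 3 ≤ N → ∀ I : EncGraph M (ZMod N × Fin h),
      (linkProblem M m P Δ).IsInstance I → ∀ ident : ZMod N × Fin h → ℕ,
        Function.Injective ident → (∀ v, ident v < (N * h) ^ c) →
          (linkProblem M m P Δ).Valid I fun v => A (N * h) (I.view ident (t (N * h)) v) := by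
    intro N h hN I hI ident hinj hlt
    have : NeZero N := ⟨by omega⟩
    have hcard : Fintype.card (ZMod N × Fin h) = N * h := by
      rw [Fintype.card_prod, ZMod.card, Fintype.card_fin]
    have := hA _ I hI ident hinj (by rwa [hcard])
    rwa [hcard] at this
  -- the height and the horizontal reach of the grid of width `N`
  set H : ℕ → ℕ := fun N => genInv M.speedup (T N) with hH
  set W : ℕ → ℕ := fun N => 2 ^ M.p * M.growth (H N - 1) with hWdef
  have hlen : ∀ l y, y < l → ∀ r i, M.linkLen y r i ≤ 2 ^ M.p * M.growth (l - 1) :=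
    fun l y hy r i => (M.linkLen_le y r i).trans
      (Nat.mul_le_mul_left _ (hmono (Nat.le_sub_one_of_lt hy)))
  have hW1 : ∀ N, 1 ≤ W N := fun N => (M.one_le_linkLen _ m 0).trans (M.linkLen_le _ m 0)
  -- the cycle algorithm: simulate the grid where this is possible
  let Good : ℕ → Prop := fun N =>
    W N < N ∧ t (N * H N) + 2 < H N ∧ 4 * (t (N * H N) * W N) + 4 ≤ N
  let t' : ℕ → ℕ := fun N => if Good N then t (N * H N) * W N else T N
  have hsolv : P.problem.SolvableInTime c t' := by
    obtain ⟨F₀, hloc₀, hval₀⟩ := P.exists_local_rule hT.1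
    have hex : ∀ N, ∃ F : (ZMod N → ℕ × Bool) → ZMod N → Γ, 3 ≤ N →
        (∀ w w' x x', LegalIds c w → LegalIds c w' → WindowEq (t' N) w w' x x' →
          F w x = F w' x') ∧
        ∀ w, LegalIds c w → ∀ v, P.ConstraintsAt (fun a b => b = a + 1) (fun a => (w a).2)
          (fun a y => F w a = y) v := by
      intro N
      by_cases hN : 3 ≤ N
      · by_cases hgood : Good N
        · obtain ⟨F, hF⟩ := exists_rule_of_solves_grid hΔ hc hN (hW1 N) hgood.1 (hlen (H N))
            hgood.2.1 hgood.2.2 (F₀ 0 (fun _ => (0, false)) 0) (A (N * H N)) (hgrid N (H N) hN)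
          refine ⟨F, fun _ => ?_⟩
          simp only [t', if_pos hgood]
          exact hF
        · refine ⟨F₀ N, fun _ => ⟨fun w w' x x' _ _ hw => hloc₀ N hN w w' x x' ?_, hval₀ N hN⟩⟩
          simpa only [t', if_neg hgood] using hw
      · exact ⟨F₀ N, fun h => absurd h hN⟩
    choose F hF using hex
    exact P.solvableInTime_of_local c t' F (fun N hN => (hF N hN).1) fun N hN => (hF N hN).2
  obtain ⟨C, N₁, hC⟩ := exists_natBound_of_isBigO (hT.2 id (P.solvableInTime_id hT.1))
  obtain ⟨C', N₂, hC'⟩ := exists_natBound_of_isBigO (hT.2 t' hsolv)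
  -- `B` bounds the widths to be avoided; heights of at least `K` occur only above it
  obtain ⟨B, hB⟩ : ∃ B, B = N₁ + N₂ + 8 := ⟨_, rfl⟩
  obtain ⟨K, hK⟩ : ∃ K, K = (Finset.range B).sup H + 2 ^ (M.p + 1) * C' +
    8 * (2 ^ (M.p + 1) * C) + 6 := ⟨_, rfl⟩
  obtain ⟨n₀, hn₀⟩ := exists_mul_le_of_isLittleO hto K
  -- a large instance size for which the algorithm has to communicate
  obtain ⟨n, hn, htn⟩ : ∃ n ≥ n₀, 0 < t n := by
    obtain ⟨N, hN⟩ : ∃ N, N = n₀ + 2 ^ M.p * M.growth (3 - 1) + 3 := ⟨_, rfl⟩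
    refine ⟨N * 3, by omega, ?_⟩
    exact pos_of_solves_grid hΔ hc (by omega) (fun y hy r i =>
      (hlen 3 y hy r i).trans_lt (by omega)) (A (N * 3)) (hgrid N 3 (by omega))
  obtain ⟨N, hNdef⟩ : ∃ N, N = nHat M.speedup T n := ⟨_, rfl⟩
  have hKH : K ≤ H N := by
    have := hn₀ n hn
    rw [← hNdef] at this
    exact (Nat.le_mul_of_pos_right K htn).trans this
  have hBN : B ≤ N := by
    by_contra hlt
    have : H N ≤ (Finset.range B).sup H := Finset.le_sup (Finset.mem_range.2 (not_le.1 hlt))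
    omega
  have hN0 : nHat M.speedup T n ≠ 0 := by omega
  -- the grid of width `N` and height `H N` has an instance size with the same `nHat`
  have hsize : K * t (N * H N) ≤ H N := by
    have h1 := le_nHat_mul_genInv hN0
    have h2 := nHat_mul_genInv hN0
    rw [← hNdef] at h1 h2
    have h3 := hn₀ (N * H N) (hn.trans h1)
    rwa [h2] at h3
  have hHW : H N * W N < 2 ^ (M.p + 1) * T N := genInv_speedup_mul_lt (show 2 ≤ H N by omega)
  have hTN : T N ≤ C * N := hC N (by omega)
  obtain ⟨s, hs⟩ : ∃ s, s = t (N * H N) := ⟨_, rfl⟩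
  rw [← hs] at hsize
  have hHWN : H N * W N < 2 ^ (M.p + 1) * C * N :=
    hHW.trans_le (by rw [mul_assoc]; exact Nat.mul_le_mul_left _ hTN)
  have hsW : K * (s * W N) ≤ H N * W N := by
    rw [← mul_assoc]; exact Nat.mul_le_mul_right _ hsize
  have hgood : Good N := by
    refine ⟨?_, ?_, ?_⟩
    · by_contra hlt
      have : 2 ^ (M.p + 1) * C * N ≤ H N * W N := Nat.mul_le_mul (by omega) (not_lt.1 hlt)
      omega
    · rw [← hs]
      have : 6 * s ≤ H N := (Nat.mul_le_mul_right s (by omega)).trans hsize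
      omega
    · rw [← hs]
      have h8 : 8 * (s * W N) < N := by
        by_contra hlt
        have : 2 ^ (M.p + 1) * C * N ≤ K * (s * W N) := by
          calc 2 ^ (M.p + 1) * C * N ≤ 2 ^ (M.p + 1) * C * (8 * (s * W N)) :=
                Nat.mul_le_mul_left _ (not_lt.1 hlt)
            _ = 8 * (2 ^ (M.p + 1) * C) * (s * W N) := by ring
            _ ≤ K * (s * W N) := Nat.mul_le_mul_right _ (by omega)
        omega
      omega
  -- on this cycle the simulation is too fast to be possible
  have hfast : T N ≤ C' * (s * W N) := by
    have := hC' N (by omega)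
    simp only [t', if_pos hgood, ← hs] at this
    exact this
  have : 2 ^ (M.p + 1) * T N ≤ K * (s * W N) := by
    calc 2 ^ (M.p + 1) * T N ≤ 2 ^ (M.p + 1) * (C' * (s * W N)) := Nat.mul_le_mul_left _ hfast
      _ = 2 ^ (M.p + 1) * C' * (s * W N) := by ring
      _ ≤ K * (s * W N) := Nat.mul_le_mul_right _ (by omega)
  omega
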